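/- Let $n\ge 0$ be an integer, $T>0$, $\Delta_*[0,T]=\{(t,s)\in[0,T]^2: t\ge s\}$ and $\Delta^*[0,T]=\{(t,s)\in[0,T]^2: t\le s\}$. Let $f:\Delta_*[0,T]\times(\mathbb R^n)^4\to\mathbb R^n$, $g:\Delta^*[0,T]\times(\mathbb R^n)^2\to\mathbb R^n$, $h:[0,T]\times(\mathbb R^n)^2\to\mathbb R^n$, $K:\Delta^*[0,T]\to\mathbb R^{n\times n}$ and $x:[0,T]\to\mathbb R^n$ be given. Assume the following. (A1) (Non-local monotonicity.) There are a smooth function $G:\mathbb R^n\to\mathbb R^n$, a symmetric positive semidefinite matrix $G_0\in\mathbb R^{n\times n}$ and constants $\gamma,C>0$ such that for all $x_1,x_2,y_1,y_2\in C([0,T];\mathbb R^n)$ and all $t\in[0,T]$, $$\int_t^T\langle \hat y(s),\hat f(s,t)\rangle\,ds-\Big\langle \hat h(t)+\int_t^T\hat g(t,s)\,ds,\ \hat x(t)\Big\rangle+\big\langle G(x_1(T))-G(x_2(T)),\hat f(T,t)\big\rangle\le-\gamma|\hat x(t)|^2,$$ where $\hat x=x_1-x_2$, $\hat y=y_1-y_2$,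 $\hat h(t)=h(t,x_1(t),x_1(T))-h(t,x_2(t),x_2(T))$, $\hat g(t,s)=g(t,s,x_1(s),y_1(s))-g(t,s,x_2(s),y_2(s))$ and $$\hat f(t,s)=f\Big(t,s,x_1(s),y_1(s),\int_s^TK(s,r)y_1(r)dr,x_1(T)\Big)-f\Big(t,s,x_2(s),y_2(s),\int_s^TK(s,r)y_2(r)dr,x_2(T)\Big),$$ and such that for all $a,b\in\mathbb R^n$, $$\langle G(a)-G(b),a-b\rangle\ge|G_0^{1/2}(a-b)|^2,\qquad |G(a)-G(b)|\le C\,|G_0^{1/2}(a-b)|.$$ (A2) The functions $f,g,h,K,x$ are continuous, and there are $L>0$ and $\alpha\in(0,1]$ such that $$|f(t_1,s,x_1,y_1,y_1',x_1')-f(t_2,s,x_2,y_2,y_2',x_2')|\le L\big(|t_1-t_2|^\alpha+|x_1-x_2|+|y_1-y_2|+|G_0(x_1'-x_2')|+|y_1'-y_2'|\big)$$ for all $(t_i,s)\in\Delta_*[0,T]$ and $x_i,y_i,y_i',x_i'\in\mathbb R^n$ ($i=1,2$), and $$|g(t_1,s,x_1,y_1)-g(t_2,s,x_2,y_2)|+|h(t_1,x_1,x_1')-h(t_2,x_2,x_2')|\le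 L\big(|t_1-t_2|^\alpha+|x_1-x_2|+|y_1-y_2|+|G_0(x_1'-x_2')|\big)$$ for all $(t_i,s)\in\Delta^*[0,T]$ and $x_i,y_i,x_i'\in\mathbb R^n$ ($i=1,2$), where $G_0$ is the matrix in (A1). Then the system $$\begin{cases}\mathcal X_s(t,s)=f\big(t,s,\mathcal X(s,s),\mathcal Y(s,s),\int_s^TK(s,r)\mathcal Y(r,r)dr,\mathcal X(T,T)\big),&(t,s)\in\Delta_*[0,T],\\ \mathcal Y_s(t,s)=-g(t,s,\mathcal X(s,s),\mathcal Y(s,s)),&(t,s)\in\Delta^*[0,T],\\ \mathcal X(t,0)=x(t),\quad \mathcal Y(t,T)=h(t,\mathcal X(t,t),\mathcal X(T,T)),&t\in[0,T],\end{cases}$$ has a unique solution $(\mathcal X,\mathcal Y)\in C(\Delta_*[0,T];\mathbb R^n)\times C(\Delta^*[0,T];\mathbb R^n)$ (for fixed $t$ the derivatives in $s$ are taken on $[0,t]$ and $[t,T]$ respectively, one-sided at the endpoints). Consequently, the coupled forward-backward Volterra integral equation $$\begin{cases}X(t)=x(t)+\int_0^tf\big(t,s,X(s),Y(s),\int_s^TK(s,r)Y(r)dr,X(T)\big)ds,\\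 Y(t)=h(t,X(t),X(T))+\int_t^Tg(t,s,X(s),Y(s))ds,\end{cases}\qquad t\in[0,T],$$ has a unique solution $(X,Y)\in C([0,T];\mathbb R^n)^2$, and it is given by $X(t)=\mathcal X(t,t)$, $Y(t)=\mathcal Y(t,t)$. -/

import Mathlib

open Set
open scoped ContDiff MatrixOrder

namespace FBVIE

/-- `ℝⁿ` with its Euclidean norm and inner product. -/
abbrev Vec (n : ℕ) : Type := EuclideanSpace ℝ (Fin n)

/-- The linear map on `ℝⁿ` given by a square matrix. -/
noncomputable abbrev act {n : ℕ} (A : Matrix (Fin n) (Fin n) ℝ) : Vec n →L[ℝ] Vec n :=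
  Matrix.toEuclideanCLM (n := Fin n) (𝕜 := ℝ) A

/-- The triangle of all `(t, s)` in `[0, T]²` with `t ≥ s` (domain of `𝒳` and `f`). -/
def lowerTriangle (T : ℝ) : Set (ℝ × ℝ) :=
  {p | p.1 ∈ Icc 0 T ∧ p.2 ∈ Icc 0 T ∧ p.2 ≤ p.1}

/-- The triangle of all `(t, s)` in `[0, T]²` with `t ≤ s` (domain of `𝒴`, `g` and `K`). -/
def upperTriangle (T : ℝ) : Set (ℝ × ℝ) :=
  {p | p.1 ∈ Icc 0 T ∧ p.2 ∈ Icc 0 T ∧ p.1 ≤ p.2}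

/-- The data of the equation: arbitrary functions `f(t,s,x,y,y',x')`, `g(t,s,x,y)`, `h(t,x,x')`,
the matrix kernel `K(s,r)` and the free term `x(t)`. Only their values on the triangles
(and on `[0, T]`) are ever used. -/
structure Coeffs (n : ℕ) where
  f : ℝ → ℝ → Vec n → Vec n → Vec n → Vec n → Vec n
  g : ℝ → ℝ → Vec n → Vec n → Vec n
  h : ℝ → Vec n → Vec n → Vec n
  K : ℝ → ℝ → Matrix (Fin n) (Fin n) ℝ
  x : ℝ → Vec n

namespace Coeffs

variable {n : ℕ}

/-- `f(t, s, x(s), y(s), ∫ₛᵀ K(s,r) y(r) dr, x(T))` along a pair of paths. -/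
noncomputable def fAlong (c : Coeffs n) (T : ℝ) (x y : ℝ → Vec n) (t s : ℝ) : Vec n :=
  c.f t s (x s) (y s) (∫ r in s..T, act (c.K s r) (y r)) (x T)

/-- `g(t, s, x(s), y(s))` along a pair of paths. -/
def gAlong (c : Coeffs n) (x y : ℝ → Vec n) (t s : ℝ) : Vec n :=
  c.g t s (x s) (y s)

/-- `h(t, x(t), x(T))` along a path. -/
def hAlong (c : Coeffs n) (T : ℝ) (x : ℝ → Vec n) (t : ℝ) : Vec n :=
  c.h t (x t) (x T)

end Coeffs

variable {n : ℕ}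

/-- The non-local monotonicity condition, with the function `G` and the positive semidefinite
matrix `G₀`, whose positive semidefinite square root is `CFC.sqrt G₀`. -/
structure NonlocalMonotone (T : ℝ) (c : Coeffs n) (G : Vec n → Vec n)
    (G₀ : Matrix (Fin n) (Fin n) ℝ) : Prop where
  posSemidef : G₀.PosSemidef
  smooth : ContDiff ℝ ∞ G
  monotone : ∃ γ : ℝ, 0 < γ ∧ ∀ x₁ x₂ y₁ y₂ : ℝ → Vec n,
    ContinuousOn x₁ (Icc 0 T) → ContinuousOn x₂ (Icc 0 T) →
    ContinuousOn y₁ (Icc 0 T) → ContinuousOn y₂ (Icc 0 T) →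
    ∀ t ∈ Icc 0 T,
      (∫ s in t..T, inner ℝ (y₁ s - y₂ s) (c.fAlong T x₁ y₁ s t - c.fAlong T x₂ y₂ s t))
        - inner ℝ ((c.hAlong T x₁ t - c.hAlong T x₂ t)
            + ∫ s in t..T, (c.gAlong x₁ y₁ t s - c.gAlong x₂ y₂ t s)) (x₁ t - x₂ t)
        + inner ℝ (G (x₁ T) - G (x₂ T)) (c.fAlong T x₁ y₁ T t - c.fAlong T x₂ y₂ T t)
      ≤ -γ * ‖x₁ t - x₂ t‖ ^ 2
  coercive : ∀ a b : Vec n,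
    ‖act (CFC.sqrt G₀) (a - b)‖ ^ 2 ≤ inner ℝ (G a - G b) (a - b)
  lipschitz : ∃ C : ℝ, 0 < C ∧ ∀ a b : Vec n,
    ‖G a - G b‖ ≤ C * ‖act (CFC.sqrt G₀) (a - b)‖

/-- The coefficients are continuous, Lipschitz in the space variables (through `G₀` in the
variable that receives `x(T)`), and Hölder in `t`. -/
structure Regular (T : ℝ) (c : Coeffs n) (G₀ : Matrix (Fin n) (Fin n) ℝ) : Prop where
  continuous_f : ContinuousOn
    (fun p : (ℝ × ℝ) × Vec n × Vec n × Vec n × Vec n =>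
      c.f p.1.1 p.1.2 p.2.1 p.2.2.1 p.2.2.2.1 p.2.2.2.2)
    (lowerTriangle T ×ˢ univ)
  continuous_g : ContinuousOn
    (fun p : (ℝ × ℝ) × Vec n × Vec n => c.g p.1.1 p.1.2 p.2.1 p.2.2)
    (upperTriangle T ×ˢ univ)
  continuous_h : ContinuousOn
    (fun p : ℝ × Vec n × Vec n => c.h p.1 p.2.1 p.2.2) (Icc 0 T ×ˢ univ)
  continuous_K : ContinuousOn (fun p : ℝ × ℝ => c.K p.1 p.2) (upperTriangle T)
  continuous_x : ContinuousOn c.x (Icc 0 T)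
  holder_lipschitz : ∃ L α : ℝ, 0 < L ∧ 0 < α ∧ α ≤ 1 ∧
    (∀ t₁ t₂ s : ℝ, (t₁, s) ∈ lowerTriangle T → (t₂, s) ∈ lowerTriangle T →
      ∀ x₁ x₂ y₁ y₂ y₁' y₂' x₁' x₂' : Vec n,
        ‖c.f t₁ s x₁ y₁ y₁' x₁' - c.f t₂ s x₂ y₂ y₂' x₂'‖
          ≤ L * (|t₁ - t₂| ^ α + ‖x₁ - x₂‖ + ‖y₁ - y₂‖ + ‖act G₀ (x₁' - x₂')‖
              + ‖y₁' - y₂'‖)) ∧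
    (∀ t₁ t₂ s : ℝ, (t₁, s) ∈ upperTriangle T → (t₂, s) ∈ upperTriangle T →
      ∀ x₁ x₂ y₁ y₂ x₁' x₂' : Vec n,
        ‖c.g t₁ s x₁ y₁ - c.g t₂ s x₂ y₂‖ + ‖c.h t₁ x₁ x₁' - c.h t₂ x₂ x₂'‖
          ≤ L * (|t₁ - t₂| ^ α + ‖x₁ - x₂‖ + ‖y₁ - y₂‖ + ‖act G₀ (x₁' - x₂')‖))

/-- `(𝒳, 𝒴)`, continuous on the two triangles, solves the two-parameter system. The derivatives
in `s` are one-sided at the endpoints of the intervals `[0, t]` and `[t, T]`. -/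
structure IsAuxSolution (T : ℝ) (c : Coeffs n) (𝒳 𝒴 : ℝ → ℝ → Vec n) : Prop where
  continuous_fst : ContinuousOn (fun p : ℝ × ℝ => 𝒳 p.1 p.2) (lowerTriangle T)
  continuous_snd : ContinuousOn (fun p : ℝ × ℝ => 𝒴 p.1 p.2) (upperTriangle T)
  deriv_fst : ∀ t s : ℝ, (t, s) ∈ lowerTriangle T →
    HasDerivWithinAt (fun s' => 𝒳 t s')
      (c.fAlong T (fun r => 𝒳 r r) (fun r => 𝒴 r r) t s) (Icc 0 t) s
  deriv_snd : ∀ t s : ℝ, (t, s) ∈ upperTriangle T →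
    HasDerivWithinAt (fun s' => 𝒴 t s')
      (-c.gAlong (fun r => 𝒳 r r) (fun r => 𝒴 r r) t s) (Icc t T) s
  initial : ∀ t ∈ Icc 0 T, 𝒳 t 0 = c.x t
  terminal : ∀ t ∈ Icc 0 T, 𝒴 t T = c.hAlong T (fun r => 𝒳 r r) t

/-- `(X, Y)`, continuous on `[0, T]`, solves the coupled forward-backward Volterra equation. -/
structure IsSolution (T : ℝ) (c : Coeffs n) (X Y : ℝ → Vec n) : Prop where
  continuous_fst : ContinuousOn X (Icc 0 T)
  continuous_snd : ContinuousOn Y (Icc 0 T)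
  forward : ∀ t ∈ Icc 0 T, X t = c.x t + ∫ s in (0 : ℝ)..t, c.fAlong T X Y t s
  backward : ∀ t ∈ Icc 0 T, Y t = c.hAlong T X t + ∫ s in t..T, c.gAlong X Y t s

end FBVIE

/-! In both equations of the two-parameter system the right-hand side depends on the unknowns only
through their diagonals. Integrating in `s` therefore makes the system equivalent to the Volterra
equation for `X(t) = 𝒳(t,t)`, `Y(t) = 𝒴(t,t)`, and the diagonal determines `𝒳` and `𝒴` on the
triangles. It remains to solve the Volterra equation uniquely, which is done by continuation in `l ∈
[0,1]`: replace `f, g, h` by `l f`, `l g`, `l h + (1-l) γ x`, with `γ` the monotonicity constant. At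
`l = 0` the equation is explicit. At `l = 1` it is the original one.

The core is an a priori bound uniform in `l` (`exists_apriori_bound`). Let `x, y` be differences of
two pairs whose residuals differ by at most `m`. Integrating the monotonicity inequality over
`[0,T]` and exchanging the order of integration turns its first two terms into `∫⟨y,x⟩ - ∫⟨y,x⟩`
plus errors of order `m`. The pairing cancels, and the coercivity of `G` leaves `γ∫|x|² + q²`, with
`q = |G₀^{1/2} x(T)|`, bounded by `m` times `∫|y| + ∫|x| + C q`. A backward Gronwall inequality
bounds `∫|y|` by `m + ∫|x| + q` up to a constant, so a quadratic inequality gives `∫|x| + q = O(m)`.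
The integral equations then bound `x` and `y` pointwise.

This bound gives uniqueness at `l = 1`. Since the residual is also Lipschitz in `l`, finitely many
contraction steps carry surjectivity from `l = 0` to `l = 1` (`surjective_of_continuation`). -/

namespace FBVIE

open intervalIntegral

/-! ### Abstract continuation argument -/

/-- Method of continuation: a family with a uniform a priori bound and Lipschitz increments in the
parameter that is onto at `0` is onto at `1`. -/
theorem surjective_of_continuation {E : Type*} [NormedAddCommGroup E] [CompleteSpace E]
    (Φ : ℝ → E → E) {M K : ℝ} (hM : 0 ≤ M) (hK : 0 ≤ K)
    (hΦ : ∀ l ∈ Icc (0 : ℝ) 1, ∀ z w, ‖z - w‖ ≤ M * ‖Φ l z - Φ l w‖)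
    (hlip : ∀ l ∈ Icc (0 : ℝ) 1, ∀ k ∈ Icc (0 : ℝ) 1, ∀ z w,
      ‖(Φ k z - Φ l z) - (Φ k w - Φ l w)‖ ≤ K * |k - l| * ‖z - w‖)
    (h0 : Function.Surjective (Φ 0)) : Function.Surjective (Φ 1) := by
  have step : ∀ l ∈ Icc (0 : ℝ) 1, ∀ k ∈ Icc (0 : ℝ) 1, M * (K * |k - l|) ≤ 1 / 2 →
      Function.Surjective (Φ l) → Function.Surjective (Φ k) := by
    intro l hl k hk hlk hs w
    choose R hR using hs
    -- `R` is a right inverse of `Φ l`, hence `M`-Lipschitz by the a priori bound. A fixed point `z`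
    -- of this map satisfies `Φ l z = w - (Φ k z - Φ l z)`, that is, `Φ k z = w`.
    have hc : ContractingWith (1 / 2) (fun z => R (w - (Φ k z - Φ l z))) := by
      refine ⟨by rw [← NNReal.coe_lt_coe]; norm_num, LipschitzWith.of_dist_le_mul fun z z' => ?_⟩
      rw [dist_eq_norm, dist_eq_norm]
      calc _ ≤ M * ‖Φ l (R (w - (Φ k z - Φ l z))) - Φ l (R (w - (Φ k z' - Φ l z')))‖ := hΦ l hl _ _
        _ = M * ‖(Φ k z - Φ l z) - (Φ k z' - Φ l z')‖ := by
          rw [hR, hR, sub_sub_sub_cancel_left, norm_sub_rev]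
        _ ≤ M * (K * |k - l| * ‖z - z'‖) := by gcongr; exact hlip l hl k hk z z'
        _ = M * (K * |k - l|) * ‖z - z'‖ := by ring
        _ ≤ 1 / 2 * ‖z - z'‖ := by gcongr
        _ = _ := by norm_num
    have hfix := hc.fixedPoint_isFixedPt
    refine ⟨hc.fixedPoint, ?_⟩
    have := congrArg (Φ l) hfix
    simp only [hR] at this
    rw [sub_eq_iff_eq_add] at this
    exact (this.trans (by abel)).symm
  -- The admissible step length does not depend on the starting point, so `N` steps of length `1 /
  -- N` cross `[0,1]`.
  obtain ⟨N, hN⟩ := exists_nat_gt (2 * (M * K))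
  have hN0 : (0 : ℝ) < N := lt_of_le_of_lt (by positivity) hN
  have key : ∀ k : ℕ, k ≤ N → Function.Surjective (Φ (k / N)) := by
    intro k
    induction k with
    | zero => intro _; simpa using h0
    | succ k ih =>
      intro hk
      have hk' : ((k : ℝ) + 1) ≤ N := by exact_mod_cast hk
      refine step (k / N) ⟨by positivity, (div_le_one hN0).2 (by linarith)⟩ _
        ⟨by positivity, (div_le_one hN0).2 (by exact_mod_cast hk)⟩ ?_ (ih (by omega))
      have : ((k + 1 : ℕ) : ℝ) / N - k / N = 1 / N := by push_cast; ring
      rw [this, abs_of_pos (by positivity), ← mul_assoc, mul_one_div, div_le_div_iff₀ hN0 two_pos]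
      linarith
  have := key N le_rfl
  rwa [div_self hN0.ne'] at this

/-! ### Integral identities and inequalities -/

theorem integral_integral_swap_triangle {T : ℝ} (hT : 0 ≤ T) {F : ℝ → ℝ → ℝ}
    (hF : Continuous (Function.uncurry F)) :
    ∫ t in 0..T, ∫ s in t..T, F t s = ∫ s in 0..T, ∫ t in 0..s, F t s := by
  -- Both sides are iterated integrals over the square of `F` cut off to `t < s`, where Fubini
  -- applies. The strict inequality only removes an endpoint of the inner `t`-integral.
  let D : Set (ℝ × ℝ) := {p | p.1 < p.2}
  have hD : MeasurableSet D := measurableSet_lt measurable_fst measurable_snd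
  have e1 : ∫ t in 0..T, ∫ s in t..T, F t s
      = ∫ t in 0..T, ∫ s in 0..T, D.indicator (Function.uncurry F) (t, s) := by
    refine integral_congr fun t ht => ?_
    rw [uIcc_of_le hT] at ht
    have : (fun s => D.indicator (Function.uncurry F) (t, s)) = (Ioi t).indicator (F t) := by
      ext s; simp [D, indicator, Function.uncurry]
    simp only [this]
    rw [integral_of_le ht.2, integral_of_le hT, MeasureTheory.setIntegral_indicator measurableSet_Ioi,
      Ioc_inter_Ioi, max_eq_right ht.1]
  have e2 : ∫ s in 0..T, ∫ t in 0..s, F t s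
      = ∫ s in 0..T, ∫ t in 0..T, D.indicator (Function.uncurry F) (t, s) := by
    refine integral_congr fun s hs => ?_
    rw [uIcc_of_le hT] at hs
    have : (fun t => D.indicator (Function.uncurry F) (t, s))
        = (Iio s).indicator (fun t => F t s) := by
      ext t; simp [D, indicator, Function.uncurry]
    simp only [this]
    rw [integral_of_le hs.1, integral_of_le hT, MeasureTheory.setIntegral_indicator measurableSet_Iio,
      MeasureTheory.integral_Ioc_eq_integral_Ioo]
    congr 2
    ext t
    simp only [mem_Ioo, mem_inter_iff, mem_Ioc, mem_Iio]
    exact ⟨fun h => ⟨⟨h.1, h.2.le.trans hs.2⟩, h.2⟩, fun h => ⟨h.1.1, h.2⟩⟩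
  rw [e1, e2]
  refine MeasureTheory.intervalIntegral_intervalIntegral_swap
    (F := fun t s => D.indicator (Function.uncurry F) (t, s)) ?_
  have : Function.uncurry (fun t s => D.indicator (Function.uncurry F) (t, s))
      = D.indicator (Function.uncurry F) := by ext ⟨t, s⟩; rfl
  rw [this]
  refine MeasureTheory.Integrable.indicator ?_ hD
  exact (hF.continuousOn.integrableOn_compact (isCompact_uIcc.prod isCompact_uIcc)).mono_set
    (prod_mono uIoc_subset_uIcc uIoc_subset_uIcc)

/-- Backward Gronwall in integrated form: `a` enters only through its integral, because the energy
estimate controls `∫‖x‖` and not `‖x t‖`. The function `k` is increasing, since the hypothesis gives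
`k' ≥ (exp (L T) - exp (L t)) v ≥ 0`; compare its values at `0` and `T`. -/
theorem integral_le_of_le_add_integral_tail {T L b : ℝ} (hT : 0 ≤ T) (hL : 0 ≤ L) (hb : 0 ≤ b)
    {u a : ℝ → ℝ} (hu : Continuous u) (ha : Continuous a) (ha0 : ∀ t, 0 ≤ a t)
    (h : ∀ t ∈ Icc 0 T, u t ≤ b + L * a t + L * ∫ s in t..T, u s) :
    ∫ s in 0..T, u s ≤ Real.exp (L * T) * (b * T + L * ∫ s in 0..T, a s) := by
  set v : ℝ → ℝ := fun s => b + L * a s with hv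
  have hvc : Continuous v := by fun_prop
  let k : ℝ → ℝ := fun t => Real.exp (L * t) * (∫ s in t..T, u s)
    + Real.exp (L * T) * ∫ s in 0..t, v s
  have hd : ∀ t, HasDerivAt k (Real.exp (L * t) * L * (∫ s in t..T, u s)
      + Real.exp (L * t) * (-u t) + Real.exp (L * T) * v t) t := by
    intro t
    have h1 : HasDerivAt (fun t => Real.exp (L * t)) (Real.exp (L * t) * L) t := by
      simpa using ((hasDerivAt_id t).const_mul L).exp
    have h2 : HasDerivAt (fun t => ∫ s in t..T, u s) (-u t) t :=
      integral_hasDerivAt_left (hu.intervalIntegrable _ _)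
        (hu.stronglyMeasurableAtFilter _ _) hu.continuousAt
    have h3 : HasDerivAt (fun t => ∫ s in 0..t, v s) (v t) t :=
      integral_hasDerivAt_right (hvc.intervalIntegrable _ _)
        (hvc.stronglyMeasurableAtFilter _ _) hvc.continuousAt
    exact (h1.mul h2).add (h3.const_mul _)
  have hmono : MonotoneOn k (Icc 0 T) := by
    refine monotoneOn_of_deriv_nonneg (convex_Icc 0 T)
      (fun t _ => (hd t).continuousAt.continuousWithinAt)
      (fun t _ => (hd t).differentiableAt.differentiableWithinAt) fun t ht => ?_
    rw [interior_Icc] at ht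
    rw [(hd t).deriv]
    have h1 := h t ⟨ht.1.le, ht.2.le⟩
    have h2 : Real.exp (L * t) ≤ Real.exp (L * T) :=
      Real.exp_le_exp.2 (mul_le_mul_of_nonneg_left ht.2.le hL)
    have hv0 : 0 ≤ v t := by have := ha0 t; positivity
    have h3 := mul_le_mul_of_nonneg_right h2 hv0
    have h4 := mul_le_mul_of_nonneg_left h1 (Real.exp_pos (L * t)).le
    simp only [hv] at h3 ⊢
    linarith
  have := hmono (left_mem_Icc.2 hT) (right_mem_Icc.2 hT) hT
  simp only [k, mul_zero, Real.exp_zero, one_mul, integral_same, add_zero, zero_add] at this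
  refine this.trans (le_of_eq ?_)
  congr 1
  simp only [hv]
  rw [integral_add (by simp) ((ha.const_mul L).intervalIntegrable _ _), integral_const_mul]
  simp [mul_comm]

/-- Cauchy–Schwarz against the constant `1`, read off from `∫ (T u - S)² ≥ 0`. -/
theorem sq_integral_le {T : ℝ} (hT : 0 < T) {u : ℝ → ℝ} (hu : Continuous u) :
    (∫ s in 0..T, u s) ^ 2 ≤ T * ∫ s in 0..T, u s ^ 2 := by
  set S := ∫ s in 0..T, u s with hS
  have h0 : 0 ≤ ∫ s in 0..T, (T * u s - S) ^ 2 :=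
    integral_nonneg hT.le fun s _ => sq_nonneg _
  have : ∀ s, (T * u s - S) ^ 2 = T ^ 2 * u s ^ 2 - 2 * T * S * u s + S ^ 2 := fun s => by ring
  simp only [this] at h0
  rw [integral_add, integral_sub, integral_const_mul, integral_const_mul, ← hS] at h0
  · simp only [intervalIntegral.integral_const, sub_zero, smul_eq_mul] at h0
    have : 0 ≤ T * (T * (∫ s in 0..T, u s ^ 2) - S ^ 2) := by linarith
    have := nonneg_of_mul_nonneg_right this hT
    linarith
  all_goals exact Continuous.intervalIntegrable (by fun_prop) _ _

theorem le_of_sq_le_mul_add {r m B : ℝ} (hm : 0 ≤ m) (hB : 0 ≤ B)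
    (h : r ^ 2 ≤ B * m * (m + r)) : r ≤ (B + 1) * m := by
  by_contra! hlt
  have h1 : 0 ≤ B * m := by positivity
  have h2 : 0 < r := by nlinarith
  have h3 : m < r - B * m := by linarith
  nlinarith [mul_lt_mul_of_pos_left h3 h2, mul_le_mul_of_nonneg_right hlt.le hm,
    mul_nonneg hB (mul_nonneg hm hm), mul_nonneg hm hm]

/-! ### The energy estimate -/

/-- Stability under perturbation: `x`, `y` are differences of solutions with free terms differing by
`φ`, `ψ`, and pointwise monotonicity bounds them by the size `m` of these. -/
theorem exists_apriori_bound {T γ C L : ℝ} (hT : 0 < T) (hγ : 0 < γ) (hC : 0 ≤ C) (hL : 0 ≤ L) :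
    ∃ M : ℝ, 0 ≤ M ∧ ∀ {V : Type*} [NormedAddCommGroup V] [InnerProductSpace ℝ V] [CompleteSpace V]
      (x y φ ψ H : ℝ → V) (F g : ℝ → ℝ → V) (p : V) (q m : ℝ),
      Continuous x → Continuous y → Continuous φ → Continuous ψ → 0 ≤ q → 0 ≤ m →
      Continuous (Function.uncurry F) →
      (∀ t ∈ Icc 0 T, x t = φ t + ∫ s in 0..t, F t s) →
      (∀ t ∈ Icc 0 T, y t = ψ t + (H t + ∫ s in t..T, g t s)) →
      (∀ t ∈ Icc 0 T, (∫ s in t..T, inner ℝ (y s) (F s t)) - inner ℝ (H t + ∫ s in t..T, g t s) (x t)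
        + inner ℝ p (F T t) ≤ -γ * ‖x t‖ ^ 2) →
      q ^ 2 ≤ inner ℝ p (x T) → ‖p‖ ≤ C * q →
      (∀ t ∈ Icc 0 T, ‖H t‖ ≤ L * (‖x t‖ + q)) →
      (∀ t ∈ Icc 0 T, ∀ s ∈ Icc t T, ‖g t s‖ ≤ L * (‖x s‖ + ‖y s‖)) →
      (∀ t ∈ Icc 0 T, ∀ s ∈ Icc 0 t,
        ‖F t s‖ ≤ L * (‖x s‖ + ‖y s‖ + q + ∫ r in 0..T, ‖y r‖)) →
      (∀ t ∈ Icc 0 T, ‖φ t‖ ≤ m) → (∀ t ∈ Icc 0 T, ‖ψ t‖ ≤ m) →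
      ∀ t ∈ Icc 0 T, ‖x t‖ ≤ M * m ∧ ‖y t‖ ≤ M * m := by
  -- `A` is the Gronwall constant for `∫‖y‖`. `c` is a common weight for `(∫‖x‖)²` and `q²` in the
  -- energy. `D` bounds `∫‖x‖ + q`, while `M1` and `M2` bound `x` and `y` pointwise, all in units of
  -- `m`.
  set A : ℝ := Real.exp (L * T) * (T + 2 * L * T + L) with hA
  have hA0 : 0 ≤ A := by positivity
  set c : ℝ := min (γ / T) 1 with hc
  have hc0 : 0 < c := by positivity
  set B : ℝ := 2 * (A + 1 + C) / c with hB
  have hB0 : 0 ≤ B := by positivity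
  set D : ℝ := B + 1 with hD
  have hD0 : 0 ≤ D := by positivity
  set M1 : ℝ := 1 + L * (D + A * (1 + D) + T * D + T * (A * (1 + D))) with hM1
  set M2 : ℝ := 1 + L * (M1 + D) + L * (D + A * (1 + D)) with hM2
  have hM10 : 0 ≤ M1 := by positivity
  have hM20 : 0 ≤ M2 := by positivity
  refine ⟨M1 + M2, by positivity, ?_⟩
  intro V _ _ _ x y φ ψ H F g p q m cx cy cφ cψ hq hm cF hx hy hmon hpx hp hH hg hF hφ hψ
  set S := ∫ s in 0..T, ‖x s‖ with hS
  set W := ∫ s in 0..T, ‖y s‖ with hW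
  have hS0 : 0 ≤ S := integral_nonneg hT.le fun s _ => norm_nonneg _
  have hW0 : 0 ≤ W := integral_nonneg hT.le fun s _ => norm_nonneg _
  have sub_le : ∀ {u : ℝ → ℝ}, Continuous u → (∀ s, 0 ≤ u s) → ∀ {a b : ℝ}, 0 ≤ a → a ≤ b → b ≤ T →
      ∫ s in a..b, u s ≤ ∫ s in 0..T, u s := fun hu hu0 a b ha hab hb =>
    integral_mono_interval ha hab hb (Filter.Eventually.of_forall hu0) (hu.intervalIntegrable _ _)
  have hgint : ∀ t ∈ Icc 0 T, ‖∫ s in t..T, g t s‖ ≤ L * (S + ∫ s in t..T, ‖y s‖) := by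
    intro t ht
    calc ‖∫ s in t..T, g t s‖ ≤ ∫ s in t..T, L * (‖x s‖ + ‖y s‖) := by
          refine norm_integral_le_of_norm_le ht.2 (Filter.Eventually.of_forall fun s hs =>
            hg t ht s ⟨hs.1.le, hs.2⟩) (Continuous.intervalIntegrable (by fun_prop) _ _)
      _ = L * ((∫ s in t..T, ‖x s‖) + ∫ s in t..T, ‖y s‖) := by
          rw [integral_const_mul, integral_add (cx.norm.intervalIntegrable _ _)
            (cy.norm.intervalIntegrable _ _)]
      _ ≤ _ := by
          gcongr
          exact sub_le cx.norm (fun _ => norm_nonneg _) ht.1 ht.2 le_rfl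
  have hynorm : ∀ t ∈ Icc 0 T, ‖y t‖ ≤ m + L * (‖x t‖ + q) + L * (S + ∫ s in t..T, ‖y s‖) := by
    intro t ht
    rw [hy t ht, ← add_assoc]
    refine (norm_add₃_le).trans ?_
    gcongr
    · exact hψ t ht
    · exact hH t ht
    · exact hgint t ht
  have hW1 : W ≤ A * (m + (S + q)) := by
    have := integral_le_of_le_add_integral_tail (b := m + L * q + L * S) hT.le hL (by positivity)
      cy.norm cx.norm (fun _ => norm_nonneg _) (fun t ht => (hynorm t ht).trans (le_of_eq (by ring)))
    refine this.trans ?_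
    rw [hA, mul_assoc]
    gcongr
    have h1 : 0 ≤ T * (S + q) + T * L * (2 * m + S + q) + L * (m + q) := by positivity
    linarith
  -- Integrated monotonicity. By `e1` and `e2` the two occurrences of `∫⟨y,x⟩` cancel; by `e3` the
  -- terminal term yields `⟨p, x T⟩ ≥ q²`. Only pairings with `φ` and `ψ` remain.
  have henergy : γ * (∫ s in 0..T, ‖x s‖ ^ 2) + q ^ 2 ≤ m * W + m * S + C * q * m := by
    have e1 : ∫ t in 0..T, ∫ s in t..T, inner ℝ (y s) (F s t)
        = (∫ s in 0..T, inner ℝ (y s) (x s)) - ∫ s in 0..T, inner ℝ (y s) (φ s) := by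
      rw [integral_integral_swap_triangle hT.le (F := fun t s => inner ℝ (y s) (F s t))
        (Continuous.inner (by fun_prop) (cF.comp continuous_swap)),
        ← integral_sub (Continuous.intervalIntegrable (by fun_prop) _ _)
          (Continuous.intervalIntegrable (by fun_prop) _ _)]
      refine integral_congr fun s hs => ?_
      rw [uIcc_of_le hT.le] at hs
      have cFs : Continuous (F s) := cF.comp (by fun_prop : Continuous fun r => (s, r))
      rw [← inner_sub_right, hx s hs, add_sub_cancel_left]
      exact ((innerSL ℝ (y s)).intervalIntegral_comp_comm (cFs.intervalIntegrable _ _))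
    have e2 : ∫ t in 0..T, inner ℝ (H t + ∫ s in t..T, g t s) (x t)
        = (∫ s in 0..T, inner ℝ (y s) (x s)) - ∫ s in 0..T, inner ℝ (ψ s) (x s) := by
      rw [← integral_sub (Continuous.intervalIntegrable (by fun_prop) _ _)
          (Continuous.intervalIntegrable (by fun_prop) _ _)]
      refine integral_congr fun s hs => ?_
      rw [uIcc_of_le hT.le] at hs
      rw [← inner_sub_left, hy s hs, add_sub_cancel_left]
    have cFT : Continuous (F T) := cF.comp (by fun_prop : Continuous fun r => (T, r))
    have e3 : ∫ t in 0..T, inner ℝ p (F T t) = inner ℝ p (x T) - inner ℝ p (φ T) := by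
      rw [← inner_sub_right, hx T ⟨hT.le, le_rfl⟩, add_sub_cancel_left]
      exact ((innerSL ℝ p).intervalIntegral_comp_comm (cFT.intervalIntegrable _ _))
    have c1 : Continuous fun t => ∫ s in t..T, (inner ℝ (y s) (F s t) : ℝ) := by
      simp_rw [integral_symm T]
      refine (continuous_parametric_intervalIntegral_of_continuous
        (f := fun t s => (inner ℝ (y s) (F s t) : ℝ)) ?_ continuous_id).neg
      exact Continuous.inner (by fun_prop) (cF.comp continuous_swap)
    -- No measurability is assumed of `H` or `g`; integrability is inherited from the equal function
    -- `y - ψ`.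
    have i2 : IntervalIntegrable (fun t => (inner ℝ (H t + ∫ s in t..T, g t s) (x t) : ℝ))
        MeasureTheory.volume 0 T := by
      refine (Continuous.intervalIntegrable (u := fun t => (inner ℝ (y t - ψ t) (x t) : ℝ))
        (by fun_prop) 0 T).congr fun s hs => ?_
      rw [uIoc_of_le hT.le] at hs
      rw [hy s ⟨hs.1.le, hs.2⟩, add_sub_cancel_left]
    have i3 : Continuous fun t => (inner ℝ p (F T t) : ℝ) := by fun_prop
    have hint := integral_mono_on hT.le
      (((c1.intervalIntegrable 0 T).sub i2).add (i3.intervalIntegrable _ _))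
      (Continuous.intervalIntegrable (by fun_prop) _ _) hmon
    rw [integral_add ((c1.intervalIntegrable 0 T).sub i2) (i3.intervalIntegrable _ _),
      integral_sub (c1.intervalIntegrable 0 T) i2, e1, e2, e3, integral_const_mul] at hint
    have b1 : ∫ s in 0..T, (inner ℝ (y s) (φ s) : ℝ) ≤ m * W := by
      rw [hW, ← integral_const_mul]
      refine integral_mono_on hT.le (Continuous.intervalIntegrable (by fun_prop) _ _)
        (Continuous.intervalIntegrable (by fun_prop) _ _) fun s hs => ?_
      refine (real_inner_le_norm _ _).trans ?_
      rw [mul_comm]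
      gcongr
      exact hφ s hs
    have b2 : -∫ s in 0..T, (inner ℝ (ψ s) (x s) : ℝ) ≤ m * S := by
      rw [hS, ← integral_const_mul, ← integral_neg]
      refine integral_mono_on hT.le (Continuous.intervalIntegrable (by fun_prop) _ _)
        (Continuous.intervalIntegrable (by fun_prop) _ _) fun s hs => ?_
      refine (neg_le_abs _).trans ((abs_real_inner_le_norm _ _).trans ?_)
      gcongr
      exact hψ s hs
    have b3 : inner ℝ p (φ T) ≤ C * q * m := by
      refine (real_inner_le_norm _ _).trans ?_
      gcongr
      exact hφ T ⟨hT.le, le_rfl⟩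
    linarith
  -- The energy bound, with Cauchy–Schwarz on the left and Gronwall for `W` on the right, reads `(S
  -- + q)² ≤ B m (m + (S + q))`.
  have hSq : S + q ≤ D * m := by
    refine le_of_sq_le_mul_add hm hB0 ?_
    have h1 := sq_integral_le hT cx.norm
    have h2 : c * S ^ 2 ≤ γ * ∫ s in 0..T, ‖x s‖ ^ 2 := by
      calc c * S ^ 2 ≤ γ / T * (T * ∫ s in 0..T, ‖x s‖ ^ 2) := by
            gcongr
            exact min_le_left _ _
        _ = _ := by field_simp
    have h3 : c * q ^ 2 ≤ 1 * q ^ 2 := by gcongr; exact min_le_right _ _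
    have h4 : c * (S + q) ^ 2 ≤ 2 * (c * S ^ 2 + c * q ^ 2) := by
      nlinarith [mul_nonneg hc0.le (sq_nonneg (S - q))]
    have h5 : m * W ≤ m * (A * (m + (S + q))) := by gcongr
    have h6 : c * (S + q) ^ 2 ≤ 2 * (A + 1 + C) * m * (m + (S + q)) := by
      have : 0 ≤ m * (q + m) + C * m * (m + S) := by positivity
      linarith
    rw [hB, div_mul_eq_mul_div, div_mul_eq_mul_div, le_div_iff₀ hc0]
    linarith
  have hSm : S ≤ D * m := by linarith
  have hqm : q ≤ D * m := by linarith
  have hWm : W ≤ A * (1 + D) * m := by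
    refine hW1.trans ?_
    linarith [mul_le_mul_of_nonneg_left hSq hA0]
  intro t ht
  have hxt : ‖x t‖ ≤ M1 * m := by
    have hFint : ‖∫ s in 0..t, F t s‖ ≤ L * (S + W + T * q + T * W) := by
      calc ‖∫ s in 0..t, F t s‖ ≤ ∫ s in 0..t, L * (‖x s‖ + ‖y s‖ + q + W) := by
            refine norm_integral_le_of_norm_le ht.1 (Filter.Eventually.of_forall fun s hs =>
              hF t ht s ⟨hs.1.le, hs.2⟩) (Continuous.intervalIntegrable (by fun_prop) _ _)
        _ ≤ ∫ s in 0..T, L * (‖x s‖ + ‖y s‖ + q + W) :=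
            sub_le (by fun_prop) (fun s => by positivity) le_rfl ht.1 ht.2
        _ = _ := by
            rw [integral_const_mul, integral_add (Continuous.intervalIntegrable (by fun_prop) _ _)
              (by simp), integral_add (Continuous.intervalIntegrable (by fun_prop) _ _) (by simp),
              integral_add (cx.norm.intervalIntegrable _ _) (cy.norm.intervalIntegrable _ _)]
            simp [hS, hW]
    calc ‖x t‖ ≤ m + L * (S + W + T * q + T * W) := by
          rw [hx t ht]
          exact (norm_add_le _ _).trans (add_le_add (hφ t ht) hFint)
      _ ≤ m + L * (D * m + A * (1 + D) * m + T * (D * m) + T * (A * (1 + D) * m)) := by gcongr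
      _ = _ := by rw [hM1]; ring
  have hyt : ‖y t‖ ≤ M2 * m := by
    calc ‖y t‖ ≤ m + L * (‖x t‖ + q) + L * (S + W) := by
          refine (hynorm t ht).trans ?_
          gcongr
          exact sub_le cy.norm (fun _ => norm_nonneg _) ht.1 ht.2 le_rfl
      _ ≤ m + L * (M1 * m + D * m) + L * (D * m + A * (1 + D) * m) := by gcongr
      _ = _ := by rw [hM2]; ring
  constructor
  · refine hxt.trans ?_
    gcongr
    linarith
  · refine hyt.trans ?_
    gcongr
    linarith

/-! ### Extension of the coefficients off the triangles -/

variable {n : ℕ}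

/-- The nearest-point retraction of `ℝ` onto `[0, T]`. -/
noncomputable def clamp (T t : ℝ) : ℝ := max 0 (min T t)

@[fun_prop]
theorem continuous_clamp (T : ℝ) : Continuous (clamp T) := by
  unfold clamp; fun_prop

theorem clamp_mem {T : ℝ} (hT : 0 ≤ T) (t : ℝ) : clamp T t ∈ Icc 0 T :=
  ⟨le_max_left _ _, max_le hT (min_le_left _ _)⟩

theorem clamp_of_mem {T t : ℝ} (ht : t ∈ Icc 0 T) : clamp T t = t := by
  rw [clamp, min_eq_right ht.2, max_eq_right ht.1]

theorem max_clamp_mem {T : ℝ} (hT : 0 ≤ T) (t s : ℝ) : max (clamp T t) (clamp T s) ∈ Icc 0 T :=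
  ⟨le_max_of_le_left (clamp_mem hT t).1, max_le (clamp_mem hT t).2 (clamp_mem hT s).2⟩

/-- The extension of the coefficients to all real times by retraction onto the triangles. -/
noncomputable def Coeffs.extend (T : ℝ) (c : Coeffs n) : Coeffs n where
  f t s := c.f (max (clamp T t) (clamp T s)) (clamp T s)
  g t s := c.g (clamp T t) (max (clamp T t) (clamp T s))
  h t := c.h (clamp T t)
  K t s := c.K (clamp T t) (max (clamp T t) (clamp T s))
  x t := c.x (clamp T t)

/-- Joint continuity of the coefficients on the whole space. -/
structure Coeffs.IsContinuous (c : Coeffs n) : Prop where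
  f : Continuous fun p : (ℝ × ℝ) × Vec n × Vec n × Vec n × Vec n =>
    c.f p.1.1 p.1.2 p.2.1 p.2.2.1 p.2.2.2.1 p.2.2.2.2
  g : Continuous fun p : (ℝ × ℝ) × Vec n × Vec n => c.g p.1.1 p.1.2 p.2.1 p.2.2
  h : Continuous fun p : ℝ × Vec n × Vec n => c.h p.1 p.2.1 p.2.2
  K : Continuous fun p : ℝ × ℝ => c.K p.1 p.2
  x : Continuous c.x

theorem Regular.isContinuous_extend {T : ℝ} (hT : 0 ≤ T) {c : Coeffs n}
    {G₀ : Matrix (Fin n) (Fin n) ℝ} (h : Regular T c G₀) : (c.extend T).IsContinuous where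
  f := h.continuous_f.comp_continuous
    (f := fun p : (ℝ × ℝ) × Vec n × Vec n × Vec n × Vec n =>
      ((max (clamp T p.1.1) (clamp T p.1.2), clamp T p.1.2), p.2)) (by fun_prop)
    fun p => ⟨⟨max_clamp_mem hT _ _, clamp_mem hT _, le_max_right _ _⟩, mem_univ _⟩
  g := h.continuous_g.comp_continuous
    (f := fun p : (ℝ × ℝ) × Vec n × Vec n =>
      ((clamp T p.1.1, max (clamp T p.1.1) (clamp T p.1.2)), p.2)) (by fun_prop)
    fun p => ⟨⟨clamp_mem hT _, max_clamp_mem hT _ _, le_max_left _ _⟩, mem_univ _⟩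
  h := h.continuous_h.comp_continuous
    (f := fun p : ℝ × Vec n × Vec n => (clamp T p.1, p.2)) (by fun_prop)
    fun p => ⟨clamp_mem hT _, mem_univ _⟩
  K := h.continuous_K.comp_continuous
    (f := fun p : ℝ × ℝ => (clamp T p.1, max (clamp T p.1) (clamp T p.2))) (by fun_prop)
    fun p => ⟨clamp_mem hT _, max_clamp_mem hT _ _, le_max_left _ _⟩
  x := h.continuous_x.comp_continuous (continuous_clamp T) fun t => clamp_mem hT t

namespace Coeffs

variable {c : Coeffs n} {T : ℝ} {x y x' y' : ℝ → Vec n}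

/-- The paths may change along with the coefficients: solutions are continuous only on `[0,T]`,
while the estimates use paths continuous on `ℝ`. -/
theorem extend_fAlong (hx : EqOn x x' (Icc 0 T)) (hy : EqOn y y' (Icc 0 T)) {t s : ℝ}
    (hts : (t, s) ∈ lowerTriangle T) :
    (c.extend T).fAlong T x y t s = c.fAlong T x' y' t s := by
  obtain ⟨ht, hs, hst⟩ := hts
  have hT : T ∈ Icc 0 T := ⟨ht.1.trans ht.2, le_rfl⟩
  have : ∫ r in s..T, act ((c.extend T).K s r) (y r) = ∫ r in s..T, act (c.K s r) (y' r) := by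
    refine integral_congr fun r hr => ?_
    rw [uIcc_of_le hs.2] at hr
    have hr' : r ∈ Icc 0 T := ⟨hs.1.trans hr.1, hr.2⟩
    simp only [extend, clamp_of_mem hs, clamp_of_mem hr', max_eq_right hr.1, hy hr']
  rw [fAlong, fAlong, this, hx hs, hy hs, hx hT]
  simp only at ht hs hst
  simp only [extend, clamp_of_mem ht, clamp_of_mem hs, max_eq_left hst]

theorem extend_gAlong (hx : EqOn x x' (Icc 0 T)) (hy : EqOn y y' (Icc 0 T)) {t s : ℝ}
    (hts : (t, s) ∈ upperTriangle T) :
    (c.extend T).gAlong x y t s = c.gAlong x' y' t s := by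
  obtain ⟨ht, hs, hst⟩ := hts
  simp only at ht hs hst
  simp only [gAlong, hx hs, hy hs, extend, clamp_of_mem ht, clamp_of_mem hs, max_eq_right hst]

theorem extend_hAlong (hx : EqOn x x' (Icc 0 T)) {t : ℝ} (ht : t ∈ Icc 0 T) :
    (c.extend T).hAlong T x t = c.hAlong T x' t := by
  simp only [hAlong, hx ht, hx (⟨ht.1.trans ht.2, le_rfl⟩ : T ∈ Icc 0 T), extend, clamp_of_mem ht]

theorem integral_extend_fAlong (hx : EqOn x x' (Icc 0 T)) (hy : EqOn y y' (Icc 0 T)) {t s : ℝ}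
    (hts : (t, s) ∈ lowerTriangle T) :
    ∫ r in 0..s, (c.extend T).fAlong T x y t r = ∫ r in 0..s, c.fAlong T x' y' t r := by
  refine integral_congr fun r hr => extend_fAlong hx hy ?_
  rw [uIcc_of_le hts.2.1.1] at hr
  exact ⟨hts.1, ⟨hr.1, hr.2.trans hts.2.1.2⟩, hr.2.trans hts.2.2⟩

theorem integral_extend_gAlong (hx : EqOn x x' (Icc 0 T)) (hy : EqOn y y' (Icc 0 T)) {t s : ℝ}
    (hts : (t, s) ∈ upperTriangle T) :
    ∫ r in s..T, (c.extend T).gAlong x y t r = ∫ r in s..T, c.gAlong x' y' t r := by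
  refine integral_congr fun r hr => extend_gAlong hx hy ?_
  rw [uIcc_of_le hts.2.1.2] at hr
  exact ⟨hts.1, ⟨hts.2.1.1.trans hr.1, hr.2⟩, hts.2.2.trans hr.1⟩

end Coeffs

theorem NonlocalMonotone.extend {T : ℝ} {c : Coeffs n} {G : Vec n → Vec n}
    {G₀ : Matrix (Fin n) (Fin n) ℝ} (h : NonlocalMonotone T c G G₀) :
    NonlocalMonotone T (c.extend T) G G₀ := by
  refine { h with monotone := ?_ }
  obtain ⟨γ, hγ, hmon⟩ := h.monotone
  refine ⟨γ, hγ, fun x₁ x₂ y₁ y₂ h₁ h₂ h₃ h₄ t ht => ?_⟩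
  have hT : T ∈ Icc 0 T := ⟨ht.1.trans ht.2, le_rfl⟩
  have hTt : (T, t) ∈ lowerTriangle T := ⟨hT, ht, ht.2⟩
  have e₁ : ∫ s in t..T, (inner ℝ (y₁ s - y₂ s)
        ((c.extend T).fAlong T x₁ y₁ s t - (c.extend T).fAlong T x₂ y₂ s t) : ℝ)
      = ∫ s in t..T, inner ℝ (y₁ s - y₂ s) (c.fAlong T x₁ y₁ s t - c.fAlong T x₂ y₂ s t) := by
    refine integral_congr fun s hs => ?_
    rw [uIcc_of_le ht.2] at hs
    have hst : (s, t) ∈ lowerTriangle T := ⟨⟨ht.1.trans hs.1, hs.2⟩, ht, hs.1⟩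
    simp only [Coeffs.extend_fAlong (eqOn_refl _ _) (eqOn_refl _ _) hst]
  have e₂ : ∫ s in t..T, ((c.extend T).gAlong x₁ y₁ t s - (c.extend T).gAlong x₂ y₂ t s)
      = ∫ s in t..T, (c.gAlong x₁ y₁ t s - c.gAlong x₂ y₂ t s) := by
    refine integral_congr fun s hs => ?_
    rw [uIcc_of_le ht.2] at hs
    have hst : (t, s) ∈ upperTriangle T := ⟨ht, ⟨ht.1.trans hs.1, hs.2⟩, hs.1⟩
    simp only [Coeffs.extend_gAlong (eqOn_refl _ _) (eqOn_refl _ _) hst]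
  rw [e₁, e₂, Coeffs.extend_hAlong (eqOn_refl _ _) ht, Coeffs.extend_hAlong (eqOn_refl _ _) ht,
    Coeffs.extend_fAlong (eqOn_refl _ _) (eqOn_refl _ _) hTt,
    Coeffs.extend_fAlong (eqOn_refl _ _) (eqOn_refl _ _) hTt]
  exact hmon x₁ x₂ y₁ y₂ h₁ h₂ h₃ h₄ t ht

theorem Regular.extend {T : ℝ} (hT : 0 ≤ T) {c : Coeffs n} {G₀ : Matrix (Fin n) (Fin n) ℝ}
    (h : Regular T c G₀) : Regular T (c.extend T) G₀ where
  continuous_f := (h.isContinuous_extend hT).f.continuousOn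
  continuous_g := (h.isContinuous_extend hT).g.continuousOn
  continuous_h := (h.isContinuous_extend hT).h.continuousOn
  continuous_K := (h.isContinuous_extend hT).K.continuousOn
  continuous_x := (h.isContinuous_extend hT).x.continuousOn
  holder_lipschitz := by
    obtain ⟨L, α, hL, hα, hα1, hf, hg⟩ := h.holder_lipschitz
    refine ⟨L, α, hL, hα, hα1, ?_, ?_⟩
    · rintro t₁ t₂ s ⟨h₁, hs, hs₁⟩ ⟨h₂, _, hs₂⟩
      simpa only [Coeffs.extend, clamp_of_mem h₁, clamp_of_mem h₂, clamp_of_mem hs,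
        max_eq_left hs₁, max_eq_left hs₂] using hf t₁ t₂ s ⟨h₁, hs, hs₁⟩ ⟨h₂, hs, hs₂⟩
    · rintro t₁ t₂ s ⟨h₁, hs, hs₁⟩ ⟨h₂, _, hs₂⟩
      simpa only [Coeffs.extend, clamp_of_mem h₁, clamp_of_mem h₂, clamp_of_mem hs,
        max_eq_right hs₁, max_eq_right hs₂] using hg t₁ t₂ s ⟨h₁, hs, hs₁⟩ ⟨h₂, hs, hs₂⟩

/-! ### Continuity and Lipschitz bounds along paths -/

theorem continuous_act : Continuous (act : Matrix (Fin n) (Fin n) ℝ → Vec n →L[ℝ] Vec n) :=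
  LinearMap.continuous_of_finiteDimensional
    ((Matrix.toEuclideanCLM (n := Fin n) (𝕜 := ℝ)).toAlgEquiv.toLinearMap)

namespace Coeffs.IsContinuous

variable {c : Coeffs n} {x y : ℝ → Vec n}

theorem kernel (hc : c.IsContinuous) (hy : Continuous y) :
    Continuous fun p : ℝ × ℝ => act (c.K p.1 p.2) (y p.2) :=
  (continuous_act.comp hc.K).clm_apply (hy.comp continuous_snd)

theorem integral_kernel (hc : c.IsContinuous) (T : ℝ) (hy : Continuous y) :
    Continuous fun s => ∫ r in s..T, act (c.K s r) (y r) := by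
  simp_rw [integral_symm T]
  exact (continuous_parametric_intervalIntegral_of_continuous
    (f := fun s r => act (c.K s r) (y r)) (hc.kernel hy) continuous_id).neg

theorem fAlong (hc : c.IsContinuous) (T : ℝ) (hx : Continuous x) (hy : Continuous y) :
    Continuous (Function.uncurry (c.fAlong T x y)) := by
  exact hc.f.comp (continuous_id.prodMk ((hx.comp continuous_snd).prodMk
    ((hy.comp continuous_snd).prodMk
      (((hc.integral_kernel T hy).comp continuous_snd).prodMk continuous_const))))

theorem gAlong (hc : c.IsContinuous) (hx : Continuous x) (hy : Continuous y) :
    Continuous (Function.uncurry (c.gAlong x y)) :=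
  hc.g.comp (by fun_prop : Continuous fun p : ℝ × ℝ => (p, x p.2, y p.2))

theorem hAlong (hc : c.IsContinuous) (T : ℝ) (hx : Continuous x) : Continuous (c.hAlong T x) :=
  hc.h.comp (by fun_prop : Continuous fun t : ℝ => (t, x t, x T))

theorem integral_fAlong (hc : c.IsContinuous) (T : ℝ) (hx : Continuous x) (hy : Continuous y) :
    Continuous fun p : ℝ × ℝ => ∫ r in 0..p.2, c.fAlong T x y p.1 r :=
  continuous_parametric_primitive_of_continuous (hc.fAlong T hx hy)

theorem integral_gAlong (hc : c.IsContinuous) (T : ℝ) (hx : Continuous x) (hy : Continuous y) :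
    Continuous fun p : ℝ × ℝ => ∫ r in p.2..T, c.gAlong x y p.1 r := by
  simp_rw [integral_symm T]
  exact (continuous_parametric_primitive_of_continuous (hc.gAlong hx hy)).neg

end Coeffs.IsContinuous

theorem act_eq_act_sqrt {G₀ : Matrix (Fin n) (Fin n) ℝ} (h : G₀.PosSemidef) (v : Vec n) :
    act G₀ v = act (CFC.sqrt G₀) (act (CFC.sqrt G₀) v) := by
  have : act G₀ = act (CFC.sqrt G₀) * act (CFC.sqrt G₀) := by
    rw [act, act, ← map_mul, CFC.sqrt_mul_sqrt_self G₀ h.nonneg]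
  rw [this]; rfl

/-- The kernel is bounded on the compact square. The non-local term thus costs only `∫‖y₁ - y₂‖`
over `[0,T]`, the quantity that Gronwall controls. -/
theorem exists_norm_integral_clm_sub_le {V : Type*} [NormedAddCommGroup V] [NormedSpace ℝ V]
    {A : ℝ → ℝ → V →L[ℝ] V} (hA : Continuous fun p : ℝ × ℝ => A p.1 p.2) {T : ℝ} (hT : 0 ≤ T) :
    ∃ κ : ℝ, 0 ≤ κ ∧ ∀ y₁ y₂ : ℝ → V, Continuous y₁ → Continuous y₂ → ∀ s ∈ Icc 0 T,
      ‖(∫ r in s..T, A s r (y₁ r)) - ∫ r in s..T, A s r (y₂ r)‖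
        ≤ κ * ∫ r in 0..T, ‖y₁ r - y₂ r‖ := by
  obtain ⟨κ, hκ⟩ :=
    (isCompact_Icc.prod isCompact_Icc : IsCompact (Icc 0 T ×ˢ Icc 0 T)).exists_bound_of_continuousOn
      hA.continuousOn
  have h00 : (0 : ℝ) ∈ Icc 0 T := ⟨le_rfl, hT⟩
  have hκ0 : 0 ≤ κ := (norm_nonneg _).trans (hκ (0, 0) ⟨h00, h00⟩)
  refine ⟨κ, hκ0, fun y₁ y₂ hy₁ hy₂ s hs => ?_⟩
  have ck : ∀ {y : ℝ → V}, Continuous y → Continuous fun r => A s r (y r) :=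
    fun hy => (hA.comp (by fun_prop : Continuous fun r : ℝ => (s, r))).clm_apply hy
  have cn : Continuous fun r => κ * ‖y₁ r - y₂ r‖ := by fun_prop
  rw [← integral_sub ((ck hy₁).intervalIntegrable _ _) ((ck hy₂).intervalIntegrable _ _),
    ← integral_const_mul]
  have hle : ∀ r ∈ Ioc s T, ‖A s r (y₁ r) - A s r (y₂ r)‖ ≤ κ * ‖y₁ r - y₂ r‖ := fun r hr => by
    rw [← map_sub]
    exact (ContinuousLinearMap.le_opNorm _ _).trans (mul_le_mul_of_nonneg_right
      (hκ (s, r) ⟨hs, hs.1.trans hr.1.le, hr.2⟩) (norm_nonneg _))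
  refine (norm_integral_le_of_norm_le hs.2 (Filter.Eventually.of_forall hle)
    (cn.intervalIntegrable _ _)).trans ?_
  exact integral_mono_interval hs.1 hs.2 le_rfl
    (Filter.Eventually.of_forall fun r => mul_nonneg hκ0 (norm_nonneg _))
    (cn.intervalIntegrable _ _)

/-- The coefficients are Lipschitz through `G₀`, whereas coercivity controls `G₀^{1/2}`; factoring
`G₀` as a square reconciles the two. -/
theorem norm_act_le_mul_norm_act_sqrt {G₀ : Matrix (Fin n) (Fin n) ℝ} (h : G₀.PosSemidef)
    (v : Vec n) : ‖act G₀ v‖ ≤ ‖act (CFC.sqrt G₀)‖ * ‖act (CFC.sqrt G₀) v‖ := by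
  rw [act_eq_act_sqrt h]
  exact ContinuousLinearMap.le_opNorm _ _

/-- Regularity is applied at equal times, where `|t - t| ^ α = 0` because `α > 0`. The bounds are
stated in the quantities of `exists_apriori_bound`. -/
theorem Regular.exists_lipschitz_along {T : ℝ} (hT : 0 ≤ T) {c : Coeffs n}
    {G₀ : Matrix (Fin n) (Fin n) ℝ} (h : Regular T c G₀) (hc : c.IsContinuous)
    (hG₀ : G₀.PosSemidef) :
    ∃ L : ℝ, 0 ≤ L ∧ ∀ x₁ x₂ y₁ y₂ : ℝ → Vec n, Continuous y₁ → Continuous y₂ → ∀ t ∈ Icc 0 T,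
      (∀ s ∈ Icc 0 t, ‖c.fAlong T x₁ y₁ t s - c.fAlong T x₂ y₂ t s‖
        ≤ L * (‖x₁ s - x₂ s‖ + ‖y₁ s - y₂ s‖ + ‖act (CFC.sqrt G₀) (x₁ T - x₂ T)‖
          + ∫ r in 0..T, ‖y₁ r - y₂ r‖)) ∧
      (∀ s ∈ Icc t T, ‖c.gAlong x₁ y₁ t s - c.gAlong x₂ y₂ t s‖
        ≤ L * (‖x₁ s - x₂ s‖ + ‖y₁ s - y₂ s‖)) ∧
      ‖c.hAlong T x₁ t - c.hAlong T x₂ t‖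
        ≤ L * (‖x₁ t - x₂ t‖ + ‖act (CFC.sqrt G₀) (x₁ T - x₂ T)‖) := by
  obtain ⟨L, α, hL, hα, -, hf, hgh⟩ := h.holder_lipschitz
  obtain ⟨κ, hκ, hK⟩ := exists_norm_integral_clm_sub_le
    (A := fun s r => act (c.K s r)) (continuous_act.comp hc.K) hT
  obtain ⟨σ, hσ, hG⟩ : ∃ σ : ℝ, 0 ≤ σ ∧ ∀ v, ‖act G₀ v‖ ≤ σ * ‖act (CFC.sqrt G₀) v‖ :=
    ⟨_, norm_nonneg _, norm_act_le_mul_norm_act_sqrt hG₀⟩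
  have h0 : (0 : ℝ) ^ α = 0 := Real.zero_rpow hα.ne'
  have key : ∀ {a b q q' i i' : ℝ}, 0 ≤ a → 0 ≤ q → 0 ≤ i → q' ≤ σ * q → i' ≤ κ * i →
      b ≤ L * (a + q' + i') → b ≤ L * (1 + σ + κ) * (a + q + i) := by
    intro a b q q' i i' ha hq hi hq' hi' hb
    refine hb.trans ?_
    rw [mul_assoc]
    refine mul_le_mul_of_nonneg_left ?_ hL.le
    have : 0 ≤ (σ + κ) * a + (1 + κ) * q + (1 + σ) * i := by positivity
    linarith
  refine ⟨L * (1 + σ + κ), by positivity, fun x₁ x₂ y₁ y₂ hy₁ hy₂ t ht => ⟨?_, ?_, ?_⟩⟩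
  · intro s hs
    have hsT : s ∈ Icc 0 T := ⟨hs.1, hs.2.trans ht.2⟩
    have hts : (t, s) ∈ lowerTriangle T := ⟨ht, hsT, hs.2⟩
    have := hf t t s hts hts (x₁ s) (x₂ s) (y₁ s) (y₂ s) (∫ r in s..T, act (c.K s r) (y₁ r))
      (∫ r in s..T, act (c.K s r) (y₂ r)) (x₁ T) (x₂ T)
    rw [sub_self, abs_zero, h0, zero_add] at this
    exact key (add_nonneg (norm_nonneg _) (norm_nonneg _)) (norm_nonneg _)
      (integral_nonneg hT fun _ _ => norm_nonneg _) (hG _) (hK y₁ y₂ hy₁ hy₂ s hsT) this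
  · intro s hs
    have hts : (t, s) ∈ upperTriangle T := ⟨ht, ⟨ht.1.trans hs.1, hs.2⟩, hs.1⟩
    -- The increments of `g` and `h` are bounded jointly. Equal terminal arguments remove the `G₀`
    -- term, absent from `g`, and the `h` increment is dropped as nonnegative.
    have := hgh t t s hts hts (x₁ s) (x₂ s) (y₁ s) (y₂ s) 0 0
    rw [sub_self t, abs_zero, h0, zero_add, sub_self (0 : Vec n), map_zero, norm_zero] at this
    have := key (a := ‖x₁ s - x₂ s‖ + ‖y₁ s - y₂ s‖) (i := 0) (i' := 0) (q := 0)
      (q' := 0) (add_nonneg (norm_nonneg _) (norm_nonneg _)) le_rfl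
      le_rfl (by simp) (by simp) ((le_add_of_nonneg_right (norm_nonneg _)).trans
        (this.trans_eq (by ring)))
    simpa only [add_zero, Coeffs.gAlong, Coeffs.hAlong] using this
  · have hts : (t, t) ∈ upperTriangle T := ⟨ht, ht, le_rfl⟩
    have := hgh t t t hts hts (x₁ t) (x₂ t) 0 0 (x₁ T) (x₂ T)
    rw [sub_self t, abs_zero, h0, zero_add, sub_self (0 : Vec n), norm_zero, add_zero] at this
    have := key (i := 0) (i' := 0) (norm_nonneg _) (norm_nonneg _) le_rfl (hG _) (by simp)
      ((le_add_of_nonneg_left (norm_nonneg _)).trans (this.trans_eq (by ring)))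
    simpa only [add_zero, Coeffs.gAlong, Coeffs.hAlong] using this

/-! ### The residual map on path space -/

variable {T : ℝ}

/-- Pairs of continuous paths on `[0, T]`, with the supremum norm. -/
abbrev PathPair (n : ℕ) (T : ℝ) : Type := C(Icc 0 T, Vec n) × C(Icc 0 T, Vec n)

namespace PathPair

/-- The first path, extended to all times by its end values. -/
noncomputable def fst (hT : 0 ≤ T) (z : PathPair n T) : ℝ → Vec n := IccExtend hT z.1

/-- The second path, extended to all times by its end values. -/
noncomputable def snd (hT : 0 ≤ T) (z : PathPair n T) : ℝ → Vec n := IccExtend hT z.2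

theorem continuous_fst (hT : 0 ≤ T) (z : PathPair n T) : Continuous (z.fst hT) :=
  z.1.continuous.Icc_extend'

theorem continuous_snd (hT : 0 ≤ T) (z : PathPair n T) : Continuous (z.snd hT) :=
  z.2.continuous.Icc_extend'

theorem fst_of_mem (hT : 0 ≤ T) (z : PathPair n T) {t : ℝ} (ht : t ∈ Icc 0 T) :
    z.fst hT t = z.1 ⟨t, ht⟩ := IccExtend_of_mem hT _ ht

theorem snd_of_mem (hT : 0 ≤ T) (z : PathPair n T) {t : ℝ} (ht : t ∈ Icc 0 T) :
    z.snd hT t = z.2 ⟨t, ht⟩ := IccExtend_of_mem hT _ ht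

theorem norm_fst_sub_le (hT : 0 ≤ T) (z w : PathPair n T) (t : ℝ) :
    ‖z.fst hT t - w.fst hT t‖ ≤ ‖z - w‖ :=
  ((z - w).1.norm_coe_le_norm (projIcc 0 T hT t)).trans (le_max_left _ _)

theorem norm_snd_sub_le (hT : 0 ≤ T) (z w : PathPair n T) (t : ℝ) :
    ‖z.snd hT t - w.snd hT t‖ ≤ ‖z - w‖ :=
  ((z - w).2.norm_coe_le_norm (projIcc 0 T hT t)).trans (le_max_right _ _)

theorem norm_le {z : PathPair n T} {M : ℝ} (hM : 0 ≤ M) (h₁ : ∀ t, ‖z.1 t‖ ≤ M)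
    (h₂ : ∀ t, ‖z.2 t‖ ≤ M) : ‖z‖ ≤ M :=
  max_le ((ContinuousMap.norm_le _ hM).2 h₁) ((ContinuousMap.norm_le _ hM).2 h₂)

end PathPair

namespace Coeffs.IsContinuous

variable {c : Coeffs n}

/-- The integral operator of the forward equation. -/
noncomputable def forwardOp (hc : c.IsContinuous) (hT : 0 ≤ T) (z : PathPair n T) :
    C(Icc 0 T, Vec n) where
  toFun t := ∫ s in 0..(t : ℝ), c.fAlong T (z.fst hT) (z.snd hT) t s
  continuous_toFun :=
    (hc.integral_fAlong T (z.continuous_fst hT) (z.continuous_snd hT)).comp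
      (by fun_prop : Continuous fun t : Icc 0 T => ((t : ℝ), (t : ℝ)))

/-- The right-hand side of the backward equation. -/
noncomputable def backwardOp (hc : c.IsContinuous) (hT : 0 ≤ T) (z : PathPair n T) :
    C(Icc 0 T, Vec n) where
  toFun t := c.hAlong T (z.fst hT) t + ∫ s in (t : ℝ)..T, c.gAlong (z.fst hT) (z.snd hT) t s
  continuous_toFun :=
    ((hc.hAlong T (z.continuous_fst hT)).comp continuous_subtype_val).add
      ((hc.integral_gAlong T (z.continuous_fst hT) (z.continuous_snd hT)).comp
        (by fun_prop : Continuous fun t : Icc 0 T => ((t : ℝ), (t : ℝ))))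

/-- The residual of the equation in which the coefficients have been replaced by `l f`, `l g` and
`l h + (1 - l) γ x`. -/
noncomputable def residual (hc : c.IsContinuous) (hT : 0 ≤ T) (γ l : ℝ) (z : PathPair n T) :
    PathPair n T :=
  (z.1 - (⟨fun t => c.x t, hc.x.comp continuous_subtype_val⟩ + l • hc.forwardOp hT z),
    z.2 - (l • hc.backwardOp hT z + ((1 - l) * γ) • z.1))

/-- At `l = 0` the system decouples: the first component gives `x` outright, and the second then
gives `y` from `γ x`. -/
theorem surjective_residual_zero (hc : c.IsContinuous) (hT : 0 ≤ T) (γ : ℝ) :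
    Function.Surjective (hc.residual hT γ 0) := by
  intro w
  refine ⟨(w.1 + ⟨fun t => c.x t, hc.x.comp continuous_subtype_val⟩,
    w.2 + γ • (w.1 + ⟨fun t => c.x t, hc.x.comp continuous_subtype_val⟩)), ?_⟩
  refine Prod.ext ?_ ?_
  · simp only [residual]; module
  · simp only [residual]; module

theorem isSolution_of_residual_eq_zero (hc : c.IsContinuous) (hT : 0 ≤ T) {γ : ℝ}
    {z : PathPair n T} (hz : hc.residual hT γ 1 z = 0) :
    IsSolution T c (z.fst hT) (z.snd hT) where
  continuous_fst := (z.continuous_fst hT).continuousOn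
  continuous_snd := (z.continuous_snd hT).continuousOn
  forward t ht := by
    have := DFunLike.congr_fun (congrArg Prod.fst hz) ⟨t, ht⟩
    simpa [residual, sub_eq_zero, forwardOp, ← z.fst_of_mem hT ht] using this
  backward t ht := by
    have := DFunLike.congr_fun (congrArg Prod.snd hz) ⟨t, ht⟩
    simpa [residual, sub_eq_zero, backwardOp, ← z.snd_of_mem hT ht] using this

theorem residual_eq_zero_of_isSolution (hc : c.IsContinuous) (hT : 0 ≤ T) {γ : ℝ}
    {z : PathPair n T} (hz : IsSolution T c (z.fst hT) (z.snd hT)) :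
    hc.residual hT γ 1 z = 0 := by
  refine Prod.ext (ContinuousMap.ext fun t => ?_) (ContinuousMap.ext fun t => ?_)
  · have := hz.forward t t.2
    rw [z.fst_of_mem hT t.2] at this
    simpa [residual, sub_eq_zero, forwardOp] using this
  · have := hz.backward t t.2
    rw [z.snd_of_mem hT t.2] at this
    simpa [residual, sub_eq_zero, backwardOp] using this

/-- The residual is affine in `l`, so the double difference is `k - l` times an increment of a fixed
Lipschitz map. -/
theorem exists_norm_residual_sub_le (hc : c.IsContinuous) (hT : 0 ≤ T)
    {G₀ : Matrix (Fin n) (Fin n) ℝ} (hG₀ : G₀.PosSemidef) (h : Regular T c G₀) (γ : ℝ) :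
    ∃ K : ℝ, 0 ≤ K ∧ ∀ (l k : ℝ) (z w : PathPair n T),
      ‖(hc.residual hT γ k z - hc.residual hT γ l z)
        - (hc.residual hT γ k w - hc.residual hT γ l w)‖ ≤ K * |k - l| * ‖z - w‖ := by
  obtain ⟨L, hL, hlip⟩ := h.exists_lipschitz_along hT hc hG₀
  obtain ⟨σ, hσ, hσv⟩ : ∃ σ : ℝ, 0 ≤ σ ∧ ∀ v, ‖act (CFC.sqrt G₀) v‖ ≤ σ * ‖v‖ :=
    ⟨_, norm_nonneg _, (act (CFC.sqrt G₀)).le_opNorm⟩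
  set K₁ := L * (2 + σ + T) * T with hK₁
  set K₂ := L * (1 + σ) + 2 * L * T + |γ| with hK₂
  have hK₁0 : 0 ≤ K₁ := by positivity
  have hK₂0 : 0 ≤ K₂ := by positivity
  refine ⟨K₁ + K₂, by positivity, fun l k z w => ?_⟩
  set N := ‖z - w‖ with hN
  have hN0 : 0 ≤ N := norm_nonneg _
  have hx := z.norm_fst_sub_le hT w
  have hy := z.norm_snd_sub_le hT w
  have hq : ‖act (CFC.sqrt G₀) (z.fst hT T - w.fst hT T)‖ ≤ σ * N :=
    (hσv _).trans (mul_le_mul_of_nonneg_left (hx T) hσ)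
  have hI : ∫ r in 0..T, ‖z.snd hT r - w.snd hT r‖ ≤ T * N := by
    refine (integral_mono_on hT (Continuous.intervalIntegrable
      ((z.continuous_snd hT).sub (w.continuous_snd hT)).norm _ _)
      (intervalIntegrable_const (c := N)) fun r _ => hy r).trans_eq (by simp)
  have hf : ‖hc.forwardOp hT z - hc.forwardOp hT w‖ ≤ K₁ * N := by
    refine (ContinuousMap.norm_le _ (by positivity)).2 fun t => ?_
    have cf : ∀ z : PathPair n T, Continuous (c.fAlong T (z.fst hT) (z.snd hT) t) := fun z =>
      (hc.fAlong T (z.continuous_fst hT) (z.continuous_snd hT)).comp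
        (by fun_prop : Continuous fun s : ℝ => ((t : ℝ), s))
    simp only [forwardOp, ContinuousMap.sub_apply, ContinuousMap.coe_mk]
    rw [← integral_sub ((cf z).intervalIntegrable _ _) ((cf w).intervalIntegrable _ _)]
    refine (norm_integral_le_of_norm_le_const (C := L * (2 + σ + T) * N) fun s hs => ?_).trans ?_
    · rw [uIoc_of_le t.2.1] at hs
      refine ((hlip _ _ _ _ (z.continuous_snd hT) (w.continuous_snd hT) t t.2).1 s
        ⟨hs.1.le, hs.2⟩).trans ?_
      rw [mul_assoc]
      refine mul_le_mul_of_nonneg_left ?_ hL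
      linarith [hx s, hy s]
    · rw [sub_zero, abs_of_nonneg t.2.1, hK₁]
      have := mul_le_mul_of_nonneg_left t.2.2 (by positivity : 0 ≤ L * (2 + σ + T) * N)
      linarith
  have hb : ‖hc.backwardOp hT z - hc.backwardOp hT w‖ ≤ (L * (1 + σ) + 2 * L * T) * N := by
    refine (ContinuousMap.norm_le _ (by positivity)).2 fun t => ?_
    have cg : ∀ z : PathPair n T, Continuous (c.gAlong (z.fst hT) (z.snd hT) t) := fun z =>
      (hc.gAlong (z.continuous_fst hT) (z.continuous_snd hT)).comp
        (by fun_prop : Continuous fun s : ℝ => ((t : ℝ), s))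
    have hl := hlip (z.fst hT) (w.fst hT) _ _ (z.continuous_snd hT) (w.continuous_snd hT) t t.2
    simp only [backwardOp, ContinuousMap.sub_apply, ContinuousMap.coe_mk]
    rw [add_sub_add_comm,
      ← integral_sub ((cg z).intervalIntegrable _ _) ((cg w).intervalIntegrable _ _), add_mul]
    refine (norm_add_le _ _).trans (add_le_add ?_ ?_)
    · refine hl.2.2.trans ?_
      rw [mul_assoc]
      refine mul_le_mul_of_nonneg_left ?_ hL
      linarith [hx t]
    · refine (norm_integral_le_of_norm_le_const (C := L * (2 * N)) fun s hs => ?_).trans ?_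
      · rw [uIoc_of_le t.2.2] at hs
        refine (hl.2.1 s ⟨hs.1.le, hs.2⟩).trans (mul_le_mul_of_nonneg_left ?_ hL)
        linarith [hx s, hy s]
      · rw [abs_of_nonneg (sub_nonneg.2 t.2.2)]
        have := mul_nonneg t.2.1 (by positivity : 0 ≤ L * (2 * N))
        linarith
  have e : (hc.residual hT γ k z - hc.residual hT γ l z)
        - (hc.residual hT γ k w - hc.residual hT γ l w)
      = (k - l) • (-(hc.forwardOp hT z - hc.forwardOp hT w),
          γ • (z.1 - w.1) - (hc.backwardOp hT z - hc.backwardOp hT w)) := by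
    refine Prod.ext ?_ ?_
    · simp only [residual, Prod.fst_sub, Prod.smul_fst]; module
    · simp only [residual, Prod.snd_sub, Prod.smul_snd]; module
  rw [e, norm_smul, Real.norm_eq_abs, mul_comm (K₁ + K₂), mul_assoc]
  refine mul_le_mul_of_nonneg_left (max_le ?_ ?_) (abs_nonneg _)
  · rw [norm_neg]
    exact hf.trans (mul_le_mul_of_nonneg_right (by linarith) hN0)
  · have h1 : ‖z.1 - w.1‖ ≤ N := le_max_left _ _
    calc _ ≤ ‖γ • (z.1 - w.1)‖ + ‖hc.backwardOp hT z - hc.backwardOp hT w‖ := norm_sub_le _ _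
      _ ≤ |γ| * N + (L * (1 + σ) + 2 * L * T) * N := by
        rw [norm_smul, Real.norm_eq_abs]
        gcongr
      _ = K₂ * N := by rw [hK₂]; ring
      _ ≤ _ := mul_le_mul_of_nonneg_right (by linarith) hN0

/-- Monotonicity survives the homotopy with the same `γ`: `l` times the hypothesis contributes `-l
γ‖x‖²`, and the added term `(1 - l) γ x` contributes `-(1 - l) γ‖x‖²`. `G` itself is not scaled,
since the factor `l` sits in `F`. -/
theorem exists_norm_sub_le_residual (hc : c.IsContinuous) (hT : 0 < T)
    {G : Vec n → Vec n} {G₀ : Matrix (Fin n) (Fin n) ℝ} (hm : NonlocalMonotone T c G G₀)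
    (h : Regular T c G₀) :
    ∃ γ M : ℝ, 0 ≤ M ∧ ∀ l ∈ Icc (0 : ℝ) 1, ∀ z w : PathPair n T,
      ‖z - w‖ ≤ M * ‖hc.residual hT.le γ l z - hc.residual hT.le γ l w‖ := by
  obtain ⟨L, hL, hlip⟩ := h.exists_lipschitz_along hT.le hc hm.posSemidef
  obtain ⟨γ, hγ, hmon⟩ := hm.monotone
  obtain ⟨C, hC, hGC⟩ := hm.lipschitz
  -- The extra `γ` in the Lipschitz constant absorbs `(1 - l) γ x` in the backward equation.
  obtain ⟨M, hM, hbound⟩ := exists_apriori_bound hT hγ hC.le (by positivity : 0 ≤ L + γ)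
  refine ⟨γ, M, hM, fun l hl z w => ?_⟩
  set r := hc.residual hT.le γ l z - hc.residual hT.le γ l w with hr
  have cx := z.continuous_fst hT.le
  have cy := z.continuous_snd hT.le
  have cx' := w.continuous_fst hT.le
  have cy' := w.continuous_snd hT.le
  have cf := (hc.fAlong T cx cy).sub (hc.fAlong T cx' cy')
  have cg := hc.gAlong cx cy
  have cg' := hc.gAlong cx' cy'
  have hl1 : 0 ≤ 1 - l := sub_nonneg.2 hl.2
  have hsmul : ∀ {v : Vec n} {b d : ℝ}, ‖v‖ ≤ L * b → 0 ≤ b → b ≤ d →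
      ‖l • v‖ ≤ (L + γ) * d := by
    intro v b d hv hb hbd
    rw [norm_smul, Real.norm_of_nonneg hl.1]
    calc l * ‖v‖ ≤ 1 * ‖v‖ := mul_le_mul_of_nonneg_right hl.2 (norm_nonneg _)
      _ ≤ (L + γ) * b := by linarith [mul_nonneg hγ.le hb]
      _ ≤ (L + γ) * d := mul_le_mul_of_nonneg_left hbd (by positivity)
  have key := hbound (fun t => z.fst hT.le t - w.fst hT.le t)
    (fun t => z.snd hT.le t - w.snd hT.le t) (r.fst hT.le) (r.snd hT.le)
    (fun t => l • (c.hAlong T (z.fst hT.le) t - c.hAlong T (w.fst hT.le) t)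
      + ((1 - l) * γ) • (z.fst hT.le t - w.fst hT.le t))
    (fun t s => l • (c.fAlong T (z.fst hT.le) (z.snd hT.le) t s
      - c.fAlong T (w.fst hT.le) (w.snd hT.le) t s))
    (fun t s => l • (c.gAlong (z.fst hT.le) (z.snd hT.le) t s
      - c.gAlong (w.fst hT.le) (w.snd hT.le) t s))
    (G (z.fst hT.le T) - G (w.fst hT.le T))
    ‖act (CFC.sqrt G₀) (z.fst hT.le T - w.fst hT.le T)‖ ‖r‖
    (cx.sub cx') (cy.sub cy') (r.continuous_fst hT.le) (r.continuous_snd hT.le)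
    (norm_nonneg _) (norm_nonneg _) (cf.const_smul l) ?_ ?_ ?_ (hm.coercive _ _) (hGC _ _)
    ?_ ?_ ?_ ?_ ?_
  · refine PathPair.norm_le (by positivity) (fun t => ?_) (fun t => ?_)
    · have := (key t t.2).1
      rwa [PathPair.fst_of_mem hT.le _ t.2, PathPair.fst_of_mem hT.le _ t.2] at this
    · have := (key t t.2).2
      rwa [PathPair.snd_of_mem hT.le _ t.2, PathPair.snd_of_mem hT.le _ t.2] at this
  · intro t ht
    have cft : ∀ z : PathPair n T, Continuous (c.fAlong T (z.fst hT.le) (z.snd hT.le) t) :=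
      fun z => (hc.fAlong T (z.continuous_fst hT.le) (z.continuous_snd hT.le)).comp
        (by fun_prop : Continuous fun s : ℝ => (t, s))
    rw [integral_smul, integral_sub ((cft z).intervalIntegrable _ _)
      ((cft w).intervalIntegrable _ _)]
    simp only [PathPair.fst_of_mem hT.le _ ht]
    simp only [hr, residual, forwardOp, Prod.fst_sub, ContinuousMap.sub_apply,
      ContinuousMap.add_apply, ContinuousMap.smul_apply, ContinuousMap.coe_mk]
    module
  · intro t ht
    have cgt : ∀ z : PathPair n T, Continuous (c.gAlong (z.fst hT.le) (z.snd hT.le) t) :=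
      fun z => (hc.gAlong (z.continuous_fst hT.le) (z.continuous_snd hT.le)).comp
        (by fun_prop : Continuous fun s : ℝ => (t, s))
    rw [integral_smul, integral_sub ((cgt z).intervalIntegrable _ _)
      ((cgt w).intervalIntegrable _ _)]
    simp only [PathPair.fst_of_mem hT.le _ ht, PathPair.snd_of_mem hT.le _ ht]
    simp only [hr, residual, backwardOp, Prod.snd_sub, ContinuousMap.sub_apply,
      ContinuousMap.add_apply, ContinuousMap.smul_apply, ContinuousMap.coe_mk]
    module
  · intro t ht
    have := mul_le_mul_of_nonneg_left (hmon _ _ _ _ cx.continuousOn cx'.continuousOn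
      cy.continuousOn cy'.continuousOn t ht) hl.1
    simp only [inner_smul_right]
    rw [integral_smul, integral_const_mul, add_right_comm, ← smul_add, inner_add_left,
      real_inner_smul_left, real_inner_smul_left, real_inner_self_eq_norm_sq]
    linarith
  · intro t ht
    have h1 := (hlip (z.fst hT.le) (w.fst hT.le) _ _ cy cy' t ht).2.2
    refine (norm_add_le _ _).trans ?_
    rw [norm_smul, norm_smul, Real.norm_of_nonneg hl.1, Real.norm_of_nonneg (by positivity)]
    have h2 := mul_le_mul_of_nonneg_right hl.2 (norm_nonneg
      (c.hAlong T (z.fst hT.le) t - c.hAlong T (w.fst hT.le) t))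
    have h3 : (1 - l) * γ * ‖z.fst hT.le t - w.fst hT.le t‖
        ≤ 1 * γ * ‖z.fst hT.le t - w.fst hT.le t‖ := by
      gcongr
      linarith [hl.1]
    have h4 := mul_nonneg hγ.le (norm_nonneg (act (CFC.sqrt G₀) (z.fst hT.le T - w.fst hT.le T)))
    linarith
  · exact fun t ht s hs => hsmul ((hlip _ _ _ _ cy cy' t ht).2.1 s hs)
      (add_nonneg (norm_nonneg _) (norm_nonneg _)) le_rfl
  · exact fun t ht s hs => hsmul ((hlip _ _ _ _ cy cy' t ht).1 s hs)
      (add_nonneg (add_nonneg (add_nonneg (norm_nonneg _) (norm_nonneg _)) (norm_nonneg _))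
        (integral_nonneg hT.le fun _ _ => norm_nonneg _)) le_rfl
  · intro t ht
    rw [r.fst_of_mem hT.le ht]
    exact (r.1.norm_coe_le_norm _).trans (le_max_left _ _)
  · intro t ht
    rw [r.snd_of_mem hT.le ht]
    exact (r.2.norm_coe_le_norm _).trans (le_max_right _ _)

theorem existsUnique_isSolution (hc : c.IsContinuous) (hT : 0 < T)
    {G : Vec n → Vec n} {G₀ : Matrix (Fin n) (Fin n) ℝ} (hm : NonlocalMonotone T c G G₀)
    (h : Regular T c G₀) :
    ∃! z : PathPair n T, IsSolution T c (z.fst hT.le) (z.snd hT.le) := by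
  obtain ⟨γ, M, hM, hbound⟩ := hc.exists_norm_sub_le_residual hT hm h
  obtain ⟨K, hK, hlip⟩ := hc.exists_norm_residual_sub_le hT.le hm.posSemidef h γ
  obtain ⟨z, hz⟩ := surjective_of_continuation (hc.residual hT.le γ) hM hK hbound
    (fun l _ k _ z w => hlip l k z w) (hc.surjective_residual_zero hT.le γ) 0
  refine ⟨z, hc.isSolution_of_residual_eq_zero hT.le hz, fun w hw => ?_⟩
  have := hbound 1 ⟨zero_le_one, le_rfl⟩ w z
  rw [hz, hc.residual_eq_zero_of_isSolution hT.le hw, sub_zero, norm_zero, mul_zero] at this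
  exact sub_eq_zero.1 (norm_le_zero_iff.1 this)

end Coeffs.IsContinuous

/-! ### Back to the original coefficients and the two-parameter system -/

theorem IsSolution.congr {c c' : Coeffs n} {X Y X' Y' : ℝ → Vec n} (h : IsSolution T c X Y)
    (hX : EqOn X' X (Icc 0 T)) (hY : EqOn Y' Y (Icc 0 T))
    (hx : ∀ t ∈ Icc 0 T, c'.x t = c.x t)
    (hf : ∀ t ∈ Icc 0 T, ∫ s in 0..t, c'.fAlong T X' Y' t s = ∫ s in 0..t, c.fAlong T X Y t s)
    (hg : ∀ t ∈ Icc 0 T, ∫ s in t..T, c'.gAlong X' Y' t s = ∫ s in t..T, c.gAlong X Y t s)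
    (hh : ∀ t ∈ Icc 0 T, c'.hAlong T X' t = c.hAlong T X t) : IsSolution T c' X' Y' where
  continuous_fst := h.continuous_fst.congr hX
  continuous_snd := h.continuous_snd.congr hY
  forward t ht := by rw [hX ht, h.forward t ht, hx t ht, hf t ht]
  backward t ht := by rw [hY ht, h.backward t ht, hh t ht, hg t ht]

theorem isSolution_extend_iff {c : Coeffs n} {X Y X' Y' : ℝ → Vec n}
    (hX : EqOn X X' (Icc 0 T)) (hY : EqOn Y Y' (Icc 0 T)) :
    IsSolution T (c.extend T) X Y ↔ IsSolution T c X' Y' := by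
  have hx : ∀ t ∈ Icc 0 T, (c.extend T).x t = c.x t := fun t ht => by
    simp only [Coeffs.extend, clamp_of_mem ht]
  have hf := fun t ht => Coeffs.integral_extend_fAlong (c := c) hX hY
    (⟨ht, ht, le_rfl⟩ : (t, t) ∈ lowerTriangle T)
  have hg := fun t ht => Coeffs.integral_extend_gAlong (c := c) hX hY
    (⟨ht, ht, le_rfl⟩ : (t, t) ∈ upperTriangle T)
  have hh := fun t (ht : t ∈ Icc 0 T) => Coeffs.extend_hAlong (c := c) hX ht
  exact ⟨fun h => h.congr hX.symm hY.symm (fun t ht => (hx t ht).symm) (fun t ht => (hf t ht).symm)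
    (fun t ht => (hg t ht).symm) (fun t ht => (hh t ht).symm), fun h => h.congr hX hY hx hf hg hh⟩

/-- For fixed `t`, each derivative in `s` is a known function of the diagonals, so the fundamental
theorem of calculus recovers `𝒳` and `𝒴` from them. This reduces uniqueness on the triangles to
uniqueness on the diagonal. -/
theorem IsAuxSolution.eq_integral {c : Coeffs n} (hT : 0 ≤ T)
    (hc : (c.extend T).IsContinuous) {𝒳 𝒴 : ℝ → ℝ → Vec n} (h : IsAuxSolution T c 𝒳 𝒴) :
    (∀ t s : ℝ, (t, s) ∈ lowerTriangle T →
      𝒳 t s = c.x t + ∫ r in 0..s, c.fAlong T (fun r => 𝒳 r r) (fun r => 𝒴 r r) t r) ∧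
    (∀ t s : ℝ, (t, s) ∈ upperTriangle T →
      𝒴 t s = c.hAlong T (fun r => 𝒳 r r) t
        + ∫ r in s..T, c.gAlong (fun r => 𝒳 r r) (fun r => 𝒴 r r) t r) := by
  -- Clamping makes the diagonals continuous on `ℝ`, so the extended integrands are continuous,
  -- hence integrable.
  have cX : Continuous fun r => 𝒳 (clamp T r) (clamp T r) :=
    h.continuous_fst.comp_continuous (f := fun r => (clamp T r, clamp T r)) (by fun_prop)
      fun r => ⟨clamp_mem hT r, clamp_mem hT r, le_rfl⟩
  have cY : Continuous fun r => 𝒴 (clamp T r) (clamp T r) :=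
    h.continuous_snd.comp_continuous (f := fun r => (clamp T r, clamp T r)) (by fun_prop)
      fun r => ⟨clamp_mem hT r, clamp_mem hT r, le_rfl⟩
  have eX : EqOn (fun r => 𝒳 (clamp T r) (clamp T r)) (fun r => 𝒳 r r) (Icc 0 T) :=
    fun r hr => by simp only [clamp_of_mem hr]
  have eY : EqOn (fun r => 𝒴 (clamp T r) (clamp T r)) (fun r => 𝒴 r r) (Icc 0 T) :=
    fun r hr => by simp only [clamp_of_mem hr]
  constructor
  · rintro t s ⟨ht, hs, hst⟩
    simp only at ht hs hst
    have cf := (hc.fAlong T cX cY).comp (by fun_prop : Continuous fun r : ℝ => (t, r))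
    have hd : ∀ r ∈ Icc 0 t, HasDerivWithinAt (𝒳 t)
        ((c.extend T).fAlong T (fun r => 𝒳 (clamp T r) (clamp T r))
          (fun r => 𝒴 (clamp T r) (clamp T r)) t r) (Icc 0 t) r := fun r hr => by
      have htr : (t, r) ∈ lowerTriangle T := ⟨ht, ⟨hr.1, hr.2.trans ht.2⟩, hr.2⟩
      rw [Coeffs.extend_fAlong eX eY htr]
      exact h.deriv_fst t r htr
    have hsub : Icc 0 s ⊆ Icc 0 t := Icc_subset_Icc_right hst
    have := integral_eq_sub_of_hasDerivAt_of_le hs.1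
      (fun r hr => ((hd r (hsub hr)).continuousWithinAt.mono hsub))
      (fun r hr => (hd r (hsub ⟨hr.1.le, hr.2.le⟩)).hasDerivAt
        (Icc_mem_nhds hr.1 (hr.2.trans_le hst))) (cf.intervalIntegrable _ _)
    rw [← Coeffs.integral_extend_fAlong eX eY ⟨ht, hs, hst⟩, this, h.initial t ht]
    abel
  · rintro t s ⟨ht, hs, hst⟩
    simp only at ht hs hst
    have cg := (hc.gAlong cX cY).comp (by fun_prop : Continuous fun r : ℝ => (t, r))
    have hd : ∀ r ∈ Icc t T, HasDerivWithinAt (𝒴 t)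
        (-(c.extend T).gAlong (fun r => 𝒳 (clamp T r) (clamp T r))
          (fun r => 𝒴 (clamp T r) (clamp T r)) t r) (Icc t T) r := fun r hr => by
      have htr : (t, r) ∈ upperTriangle T := ⟨ht, ⟨ht.1.trans hr.1, hr.2⟩, hr.1⟩
      rw [Coeffs.extend_gAlong eX eY htr]
      exact h.deriv_snd t r htr
    have hsub : Icc s T ⊆ Icc t T := Icc_subset_Icc_left hst
    have := integral_eq_sub_of_hasDerivAt_of_le hs.2
      (fun r hr => ((hd r (hsub hr)).continuousWithinAt.mono hsub))
      (fun r hr => (hd r (hsub ⟨hr.1.le, hr.2.le⟩)).hasDerivAt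
        (Icc_mem_nhds (hst.trans_lt hr.1) hr.2)) (cg.neg.intervalIntegrable _ _)
    rw [integral_neg] at this
    rw [← Coeffs.integral_extend_gAlong eX eY ⟨ht, hs, hst⟩, ← neg_neg (∫ r in s..T, _), this,
      h.terminal t ht]
    abel

theorem IsAuxSolution.isSolution {c : Coeffs n} (hT : 0 ≤ T)
    (hc : (c.extend T).IsContinuous) {𝒳 𝒴 : ℝ → ℝ → Vec n} (h : IsAuxSolution T c 𝒳 𝒴) :
    IsSolution T c (fun t => 𝒳 t t) (fun t => 𝒴 t t) where
  continuous_fst := h.continuous_fst.comp (by fun_prop : ContinuousOn (fun t => (t, t)) (Icc 0 T))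
    fun _ ht => ⟨ht, ht, le_rfl⟩
  continuous_snd := h.continuous_snd.comp (by fun_prop : ContinuousOn (fun t => (t, t)) (Icc 0 T))
    fun _ ht => ⟨ht, ht, le_rfl⟩
  forward t ht := (h.eq_integral hT hc).1 t t ⟨ht, ht, le_rfl⟩
  backward t ht := (h.eq_integral hT hc).2 t t ⟨ht, ht, le_rfl⟩

/-- A continuous solution of the integral equation spans a solution of the two-parameter system
with the same diagonal. -/
theorem IsSolution.exists_isAuxSolution {c : Coeffs n}
    (hc : (c.extend T).IsContinuous) {X Y : ℝ → Vec n} (hX : Continuous X) (hY : Continuous Y)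
    (h : IsSolution T c X Y) :
    ∃ 𝒳 𝒴 : ℝ → ℝ → Vec n, IsAuxSolution T c 𝒳 𝒴 ∧
      EqOn (fun t => 𝒳 t t) X (Icc 0 T) ∧ EqOn (fun t => 𝒴 t t) Y (Icc 0 T) := by
  have h' := (isSolution_extend_iff (eqOn_refl X _) (eqOn_refl Y _)).2 h
  set d := c.extend T with hd
  -- With the extended coefficients these are continuous on the plane and differentiable in `s` on
  -- `ℝ`; the one-sided derivatives follow by restriction.
  let 𝒳 : ℝ → ℝ → Vec n := fun t s => d.x t + ∫ r in 0..s, d.fAlong T X Y t r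
  let 𝒴 : ℝ → ℝ → Vec n := fun t s => d.hAlong T X t + ∫ r in s..T, d.gAlong X Y t r
  have e₁ : EqOn (fun t => 𝒳 t t) X (Icc 0 T) := fun t ht => (h'.forward t ht).symm
  have e₂ : EqOn (fun t => 𝒴 t t) Y (Icc 0 T) := fun t ht => (h'.backward t ht).symm
  refine ⟨𝒳, 𝒴, ⟨?_, ?_, ?_, ?_, ?_, ?_⟩, e₁, e₂⟩
  · exact ((hc.x.comp _root_.continuous_fst).add (hc.integral_fAlong T hX hY)).continuousOn
  · exact (((hc.hAlong T hX).comp _root_.continuous_fst).add (hc.integral_gAlong T hX hY)).continuousOn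
  · intro t s hts
    have cf : Continuous (d.fAlong T X Y t) :=
      (hc.fAlong T hX hY).comp (by fun_prop : Continuous fun r : ℝ => (t, r))
    rw [← Coeffs.extend_fAlong e₁.symm e₂.symm hts]
    exact ((integral_hasDerivAt_right (cf.intervalIntegrable _ _)
      (cf.stronglyMeasurableAtFilter _ _) cf.continuousAt).const_add _).hasDerivWithinAt
  · intro t s hts
    have cg : Continuous (d.gAlong X Y t) :=
      (hc.gAlong hX hY).comp (by fun_prop : Continuous fun r : ℝ => (t, r))
    rw [← Coeffs.extend_gAlong e₁.symm e₂.symm hts]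
    exact ((integral_hasDerivAt_left (cg.intervalIntegrable _ _)
      (cg.stronglyMeasurableAtFilter _ _) cg.continuousAt).const_add _).hasDerivWithinAt
  · intro t ht
    simp only [𝒳, integral_same, add_zero, hd, Coeffs.extend, clamp_of_mem ht]
  · intro t ht
    rw [← Coeffs.extend_hAlong e₁.symm ht]
    simp only [𝒴, integral_same, add_zero, hd]

end FBVIE

theorem theorem2p1 (n : ℕ) (T : ℝ) (hT : 0 < T) (c : FBVIE.Coeffs n)
    (G : FBVIE.Vec n → FBVIE.Vec n) (G₀ : Matrix (Fin n) (Fin n) ℝ)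
    (hA1 : FBVIE.NonlocalMonotone T c G G₀) (hA2 : FBVIE.Regular T c G₀) :
    ∃ 𝒳 𝒴 : ℝ → ℝ → FBVIE.Vec n,
      FBVIE.IsAuxSolution T c 𝒳 𝒴 ∧
      (∀ 𝒳' 𝒴' : ℝ → ℝ → FBVIE.Vec n, FBVIE.IsAuxSolution T c 𝒳' 𝒴' →
        (∀ t s : ℝ, (t, s) ∈ FBVIE.lowerTriangle T → 𝒳' t s = 𝒳 t s) ∧
        (∀ t s : ℝ, (t, s) ∈ FBVIE.upperTriangle T → 𝒴' t s = 𝒴 t s)) ∧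
      FBVIE.IsSolution T c (fun t => 𝒳 t t) (fun t => 𝒴 t t) ∧
      (∀ X Y : ℝ → FBVIE.Vec n, FBVIE.IsSolution T c X Y →
        ∀ t ∈ Set.Icc (0 : ℝ) T, X t = 𝒳 t t ∧ Y t = 𝒴 t t) := by
  have hc := hA2.isContinuous_extend hT.le
  obtain ⟨z, hz, huniq⟩ := hc.existsUnique_isSolution hT hA1.extend (hA2.extend hT.le)
  obtain ⟨𝒳, 𝒴, haux, hX, hY⟩ := FBVIE.IsSolution.exists_isAuxSolution hc
    (z.continuous_fst hT.le) (z.continuous_snd hT.le)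
    ((FBVIE.isSolution_extend_iff (eqOn_refl _ _) (eqOn_refl _ _)).1 hz)
  have hsol : ∀ X Y : ℝ → FBVIE.Vec n, FBVIE.IsSolution T c X Y →
      EqOn X (fun t => 𝒳 t t) (Icc 0 T) ∧ EqOn Y (fun t => 𝒴 t t) (Icc 0 T) := by
    intro X Y h
    -- Restricting an arbitrary solution to `[0,T]` gives an element of path space, where uniqueness
    -- is known.
    let w : FBVIE.PathPair n T :=
      (⟨_, h.continuous_fst.domRestrict⟩, ⟨_, h.continuous_snd.domRestrict⟩)
    have hwX : EqOn (w.fst hT.le) X (Icc 0 T) := fun t ht => w.fst_of_mem hT.le ht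
    have hwY : EqOn (w.snd hT.le) Y (Icc 0 T) := fun t ht => w.snd_of_mem hT.le ht
    have hwz := huniq w ((FBVIE.isSolution_extend_iff hwX hwY).2 h)
    rw [hwz] at hwX hwY
    exact ⟨hwX.symm.trans hX.symm, hwY.symm.trans hY.symm⟩
  refine ⟨𝒳, 𝒴, haux, fun 𝒳' 𝒴' h => ?_, haux.isSolution hT.le hc,
    fun X Y h t ht => ⟨(hsol X Y h).1 ht, (hsol X Y h).2 ht⟩⟩
  obtain ⟨eX, eY⟩ := hsol _ _ (h.isSolution hT.le hc)
  refine ⟨fun t s hts => ?_, fun t s hts => ?_⟩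
  · rw [(h.eq_integral hT.le hc).1 t s hts, (haux.eq_integral hT.le hc).1 t s hts,
      ← FBVIE.Coeffs.integral_extend_fAlong eX eY hts,
      ← FBVIE.Coeffs.integral_extend_fAlong (eqOn_refl _ _) (eqOn_refl _ _) hts]
  · rw [(h.eq_integral hT.le hc).2 t s hts, (haux.eq_integral hT.le hc).2 t s hts,
      ← FBVIE.Coeffs.integral_extend_gAlong eX eY hts,
      ← FBVIE.Coeffs.integral_extend_gAlong (eqOn_refl _ _) (eqOn_refl _ _) hts,
      ← FBVIE.Coeffs.extend_hAlong eX hts.1, ← FBVIE.Coeffs.extend_hAlong (eqOn_refl _ _) hts.1]
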